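/- **Model.** A decoder chip is a finite simple graph whose vertices are processing elements (PEs) and whose edges are wires; every PE has at most $\zeta$ neighbours. There are $k\ge 1$ message bits and $m\ge 1$ channel uses, and $R_{ch}=k/m$. Each of the $m$ channel outputs is stored in a PE of its own, and each of the $k$ decoded bits is read off a designated PE (one PE may play both roles; all other PEs are helpers). In each of $l\ge 0$ synchronous iterations every PE exchanges messages with its neighbours and updates its register by an arbitrary rule. The neighbourhood size of a message bit is the number of channel-output PEs from which its PE can receive messages, directly or relayed, within $l$ iterations (i.e. at graph distance at most $l$); $n$ is the maximum over all message bits. Every PE consumes $E_{node}>0$ joules per iteration, so $E_D$ is $E_{node}$ times the number of PEs times $l$; decoding takes time $k/R_{dec}$ with $R_{dec}>0$, so $P_D=E_DR_{dec}/k$; and $P_{total}=\xi_TP_R+\xi_DP_D$ with weights $\xi_T,\xi_D>0$ and received power $P_R\ge0$. **(a) Iterations and power.** For every such decoder $E_D\ge E_{node}\,m\,l$. If $\zeta>2$, then $$n\le \zeta\,\frac{(\zeta-1)^l-1}{\zeta-2}+1,\qquad l\ge\frac{\log\left(\frac{\zeta-2}{\zeta}n+\frac2\zeta\right)}{\log(\zeta-1)},$$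 $$P_{total}\ \ge\ \xi_TP_R+\frac{\xi_DE_{node}R_{dec}}{R_{ch}}\cdot\frac{\left(\log\left(\frac{\zeta-2}{\zeta}n+\frac2\zeta\right)\right)^+}{\log(\zeta-1)}. \qquad (*)$$ If $\zeta=2$, then $n\le 2l+1$ and $l\ge\frac{n-1}2$. **(b) Local sphere-packing bounds.** Let the $k$ message bits be uniform and independent, the code arbitrary, and $\langle P_e\rangle$ the bit-error probability averaged over the $k$ bits. Let $h_b$ be the binary entropy function in bits and $h_b^{-1}$ its inverse with values in $[0,\frac12]$. *BSC.* If the channel is a binary symmetric channel with crossover probability $0<p<\frac12$, then $\langle P_e\rangle\ge B(n)$, where $$B(n)=\sup_{g}\ \frac{h_b^{-1}(\delta(g))}{2}\,2^{-nD(g\|p)}\left(\frac{p(1-g)}{g(1-p)}\right)^{\epsilon(g)\sqrt n},$$ the supremum being over $p\le g\le\frac12$ with $C(g)<R_{ch}$, $C(g)=1-h_b(g)$, $\delta(g)=1-C(g)/R_{ch}$, $D(g\|p)=g\log_2\frac gp+(1-g)\log_2\frac{1-g}{1-p}$, $K(g)=\inf_{0<\eta<1-g}D(g+\eta\|g)/\eta^2$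 and $\epsilon(g)=\sqrt{\frac1{K(g)}\log_2\frac{2}{h_b^{-1}(\delta(g))}}$. *AWGN.* If the channel is the real additive white Gaussian noise channel with noise variance $\sigma_0^2>0$, the codebook has average power at most $P_R$ (averaged over messages and channel uses), and the decoded bits are measurable functions of the channel outputs, then $\langle P_e\rangle\ge B(n)$, where now $$B(n)=\sup_{\sigma^2}\ \frac{h_b^{-1}(\delta(\sigma^2))}{2}\exp\left(-nD(\sigma^2\|\sigma_0^2)-\sqrt n\left(\tfrac32+2\ln\tfrac{2}{h_b^{-1}(\delta(\sigma^2))}\right)\left(\tfrac{\sigma^2}{\sigma_0^2}-1\right)\right),$$ the supremum being over $\sigma^2\ge\sigma_0^2$ with $C(\sigma^2)<R_{ch}$, $C(\sigma^2)=\frac12\log_2(1+P_R/\sigma^2)$, $\delta(\sigma^2)=1-C(\sigma^2)/R_{ch}$ and $D(\sigma^2\|\sigma_0^2)=\frac12\left[\frac{\sigma^2}{\sigma_0^2}-1-\ln\frac{\sigma^2}{\sigma_0^2}\right]$. **(c) Power for a target error probability.** In both cases, if $\langle P_e\rangle\le P$ for a target $P$ and $n^*(P)$ is the least integer $N\ge0$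 with $B(N)\le P$, then $n\ge n^*(P)$, and for $\zeta>2$ the bound $(*)$ also holds with $n^*(P)$ in place of $n$. -/

import Mathlib

open MeasureTheory ProbabilityTheory
open scoped NNReal ENNReal

noncomputable section

namespace VLSIDecoding

/-! ### The VLSI model of a fully parallel message-passing decoder -/

/-- The chip: `V` is the set of processing elements (PEs), `graph` the wiring; every PE is wired to
at most `ζ` other PEs. The `j`-th channel output is stored in the PE `outputPE j`, distinct channel
outputs being stored in distinct PEs; the `i`-th decoded message bit is produced by the PE
`messagePE i`. One PE may be both an output and a message PE, and the remaining PEs are helpers. -/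
structure Architecture (V : Type*) (k m ζ : ℕ) where
  graph : SimpleGraph V
  neighbours_le : ∀ v, (graph.neighborSet v).ncard ≤ ζ
  outputPE : Fin m → V
  outputPE_injective : Function.Injective outputPE
  messagePE : Fin k → V

/-- A synchronous message-passing decoder on such a chip for `m` channel outputs in `Y` and `k`
message bits. `S` is the set of register contents and `M` the set of messages. Initially every PE
loads the channel output stored in it (`none` if there is none). In iteration `t`, PE `v` sends
`send t v w s` to its neighbour `w` when its register contains `s`, and then updates its register
from its old content and the messages that arrived from its neighbours. After `iterations`
iterations, bit `i` is read off the register of the PE `messagePE i`. The functions are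
arbitrary and may depend on the PE and on the iteration. -/
structure Decoder (Y V S M : Type*) (k m ζ : ℕ) extends Architecture V k m ζ where
  iterations : ℕ
  load : V → Option Y → S
  send : ℕ → V → V → S → M
  update : ℕ → (v : V) → S → (graph.neighborSet v → M) → S
  readout : Fin k → S → Bool

namespace Decoder

variable {Y V S M : Type*} {k m ζ : ℕ}

/-- The channel output stored in the PE `v`, if any. -/
def stored (D : Decoder Y V S M k m ζ) (y : Fin m → Y) : V → Option Y :=
  Function.extend D.outputPE (fun j => some (y j)) (fun _ => none)

/-- Register contents after `t` iterations. -/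
def state (D : Decoder Y V S M k m ζ) (y : Fin m → Y) : ℕ → V → S
  | 0, v => D.load v (D.stored y v)
  | t + 1, v => D.update t v (D.state y t v) (fun w => D.send t w v (D.state y t w))

/-- The decoded bits. -/
def decode (D : Decoder Y V S M k m ζ) (y : Fin m → Y) (i : Fin k) : Bool :=
  D.readout i (D.state y D.iterations (D.messagePE i))

/-- Neighbourhood size of the `i`-th message bit: the number of channel output nodes from which
its message node can receive messages, directly or relayed, within the decoder's iterations. -/
def nbdSize (D : Decoder Y V S M k m ζ) (i : Fin k) : ℕ :=
  Set.ncard {j : Fin m |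
    ∃ w : D.graph.Walk (D.outputPE j) (D.messagePE i), w.length ≤ D.iterations}

/-- Maximum neighbourhood size over all message bits. -/
def maxNbdSize (D : Decoder Y V S M k m ζ) : ℕ :=
  Finset.univ.sup D.nbdSize

/-- Decoding energy: every PE consumes `Enode` joules in every iteration. -/
def decodingEnergy [Fintype V] (D : Decoder Y V S M k m ζ) (Enode : ℝ) : ℝ :=
  Enode * Fintype.card V * D.iterations

/-- Decoding power: the `k` bits are decoded in time `k / Rdec`. -/
def decodingPower [Fintype V] (D : Decoder Y V S M k m ζ) (Enode Rdec : ℝ) : ℝ :=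
  D.decodingEnergy Enode / (k / Rdec)

/-- Weighted total power `ξT P_R + ξD P_D`. -/
def totalPower [Fintype V] (D : Decoder Y V S M k m ζ) (ξT ξD PR Enode Rdec : ℝ) : ℝ :=
  ξT * PR + ξD * D.decodingPower Enode Rdec

end Decoder

/-- The lower bound on the total power for neighbourhood size `n` (for `ζ > 2`). -/
def totalPowerBound (ξT ξD PR Enode Rdec Rch : ℝ) (ζ n : ℕ) : ℝ :=
  ξT * PR + ξD * Enode * Rdec / Rch *
    (max 0 (Real.log (((ζ : ℝ) - 2) / ζ * n + 2 / ζ)) / Real.log ((ζ : ℝ) - 1))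

/-! ### Channels and error probability -/

/-- Binary symmetric channel with crossover probability `p`. -/
def bsc (p : ℝ) (x : Bool) : Measure Bool :=
  ENNReal.ofReal (1 - p) • Measure.dirac x + ENNReal.ofReal p • Measure.dirac (!x)

/-- Real additive white Gaussian noise channel with noise variance `v`. -/
def awgn (v : ℝ≥0) (x : ℝ) : Measure ℝ := gaussianReal x v

/-- Error probability of the `i`-th bit, for uniform message bits, the codebook `enc` and
independent uses of the channel `W`. -/
def bitErrorProb {X Y V S M : Type*} [MeasurableSpace Y] {k m ζ : ℕ} (W : X → Measure Y)
    (enc : (Fin k → Bool) → Fin m → X) (D : Decoder Y V S M k m ζ) (i : Fin k) : ℝ :=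
  (∑ b : Fin k → Bool, (Measure.pi fun j => W (enc b j)).real {y | D.decode y i ≠ b i}) / 2 ^ k

/-- Average bit-error probability `⟨P_e⟩`. -/
def avgErrorProb {X Y V S M : Type*} [MeasurableSpace Y] {k m ζ : ℕ} (W : X → Measure Y)
    (enc : (Fin k → Bool) → Fin m → X) (D : Decoder Y V S M k m ζ) : ℝ :=
  (∑ i, bitErrorProb W enc D i) / k

/-! ### Local sphere-packing bounds -/

/-- Binary entropy function in bits. -/
def hb (x : ℝ) : ℝ := Real.binEntropy x / Real.log 2

/-- Inverse of the binary entropy function, with values in `[0, 1/2]`. -/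
def hbInv (y : ℝ) : ℝ := Function.invFunOn hb (Set.Icc 0 (1 / 2)) y

/-- Binary divergence in bits. -/
def divBSC (g p : ℝ) : ℝ :=
  g * Real.logb 2 (g / p) + (1 - g) * Real.logb 2 ((1 - g) / (1 - p))

/-- Capacity of the BSC with crossover probability `g`. -/
def capBSC (g : ℝ) : ℝ := 1 - hb g

def deltaBSC (R g : ℝ) : ℝ := 1 - capBSC g / R

def constK (g : ℝ) : ℝ := sInf ((fun η => divBSC (g + η) g / η ^ 2) '' Set.Ioo 0 (1 - g))

def epsBSC (R g : ℝ) : ℝ :=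
  Real.sqrt (1 / constK g * Real.logb 2 (2 / hbInv (deltaBSC R g)))

/-- The local sphere-packing bound for the BSC. For `R` below the capacity of the channel the range
of `g` is `C⁻¹(R) < g ≤ 1/2`, where `C⁻¹` is the inverse of `capBSC` on `[0, 1/2]`. -/
def spherePackingBSC (p R : ℝ) (n : ℕ) : EReal :=
  ⨆ g ∈ {g : ℝ | p ≤ g ∧ g ≤ 1 / 2 ∧ capBSC g < R},
    ((hbInv (deltaBSC R g) / 2 * (2 : ℝ) ^ (-(n * divBSC g p)) *
      (p * (1 - g) / (g * (1 - p))) ^ (epsBSC R g * Real.sqrt n) : ℝ) : EReal)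

/-- Capacity, in bits, of the real AWGN channel with power `PR` and noise variance `v`. -/
def capAWGN (PR v : ℝ) : ℝ := 1 / 2 * Real.logb 2 (1 + PR / v)

def deltaAWGN (R PR v : ℝ) : ℝ := 1 - capAWGN PR v / R

/-- Divergence, in nats, between centred Gaussians of variances `v` and `v₀`. -/
def divAWGN (v v₀ : ℝ) : ℝ := 1 / 2 * (v / v₀ - 1 - Real.log (v / v₀))

/-- The local sphere-packing bound for the AWGN channel. For `R` below the capacity of the channel
the condition `v₀ ≤ v` follows from `capAWGN PR v < R`. -/
def spherePackingAWGN (v₀ PR R : ℝ) (n : ℕ) : EReal :=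
  ⨆ v ∈ {v : ℝ | v₀ ≤ v ∧ capAWGN PR v < R},
    ((hbInv (deltaAWGN R PR v) / 2 *
      Real.exp (-(n * divAWGN v v₀) -
        Real.sqrt n * (3 / 2 + 2 * Real.log (2 / hbInv (deltaAWGN R PR v))) *
          (v / v₀ - 1)) : ℝ) : EReal)

/-- The neighbourhood size that a sphere-packing bound `B` demands for the error probability `P`:
the least `n` with `B n ≤ P`. -/
def requiredNbd (B : ℕ → EReal) (P : ℝ) : ℕ := sInf {n : ℕ | B n ≤ (P : EReal)}

end VLSIDecoding

end

open MeasureTheory ProbabilityTheory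
open scoped NNReal ENNReal

noncomputable section

namespace VLSIDecoding

/-! ### Products of measures with densities -/

section Product

variable {ι Y : Type*} [Fintype ι] [MeasurableSpace Y]

/-! The power bounds come from counting. Every vertex of a sphere except the centre spends one of
its `ζ` edges on a predecessor, so the sphere of radius `d + 1` has at most `ζ * (ζ - 1) ^ d`
vertices. Distinct outputs sit in distinct PEs, so summing spheres bounds `n`, and solving the
geometric sum for `l` gives the logarithm. The same distinctness gives at least `m` PEs, hence the
energy bound.

The error bounds compare the true channel `W` with a noisier test channel `W'` whose capacity is
below the rate. Behind `W'`, Fano's inequality forces an average bit-error probability of at least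
`x = h_b⁻¹(δ)` (`hbInv_le_avgErrorProb`). It is proved without mutual information: `log t ≤ t - 1`
is applied to a product-form guess of the message times a likelihood ratio, under an output law
common to all codewords.

The error event of a bit depends on only `n` outputs (`exists_finset_decode_congr`). Moving it from
`W'` to `W` therefore costs a likelihood ratio on `n` coordinates, at least `exp (-θ)` outside an
atypical set (`pi_change_of_measure`). With `θ` chosen so that this set has probability at most `x /
2`, averaging over bits and messages gives `exp (-θ) * x / 2` (`avgErrorProb_ge_of_test_channel`).
Chernoff bounds supply `θ`: `bsc_noise_tail` for the number of flips, `gaussian_noise_tail` for the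
noise energy.

The target-error form follows by minimality of the required neighbourhood size and monotonicity of
the power bound. -/

theorem lintegral_pi_prod (μ : ι → Measure Y) [∀ i, IsProbabilityMeasure (μ i)]
    {f : ι → Y → ℝ≥0∞} (hf : ∀ i, Measurable (f i)) :
    ∫⁻ y, ∏ i, f i (y i) ∂Measure.pi μ = ∏ i, ∫⁻ y, f i y ∂μ i := by
  have h := lintegral_prod_eq_prod_lintegral_of_indepFun Finset.univ
    (fun i (y : ι → Y) => f i (y i)) (iIndepFun_pi (μ := μ) (fun i => (hf i).aemeasurable))
    (fun i => (hf i).comp (measurable_pi_apply i))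
  rw [h]
  refine Finset.prod_congr rfl fun i _ => ?_
  rw [← (measurePreserving_eval μ i).lintegral_comp (hf i)]

theorem pi_eq_withDensity_exp {μ ν : ι → Measure Y} [∀ i, IsProbabilityMeasure (μ i)]
    [∀ i, IsProbabilityMeasure (ν i)] {r : ι → Y → ℝ} (hr : ∀ i, Measurable (r i))
    (h : ∀ i, ν i = (μ i).withDensity fun y => ENNReal.ofReal (Real.exp (-r i y))) :
    Measure.pi ν =
      (Measure.pi μ).withDensity fun y => ENNReal.ofReal (Real.exp (-∑ i, r i (y i))) := by
  refine Measure.pi_eq fun s hs => ?_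
  rw [withDensity_apply _ (MeasurableSet.univ_pi hs), ← lintegral_indicator (.univ_pi hs)]
  have : ∀ y : ι → Y, (Set.univ.pi s).indicator
      (fun y => ENNReal.ofReal (Real.exp (-∑ i, r i (y i)))) y =
      ∏ i, (s i).indicator (fun y => ENNReal.ofReal (Real.exp (-r i y))) (y i) := by
    intro y
    by_cases hy : y ∈ Set.univ.pi s
    · rw [Set.indicator_of_mem hy, ← Finset.sum_neg_distrib, Real.exp_sum,
        ENNReal.ofReal_prod_of_nonneg fun i _ => (Real.exp_pos _).le]
      exact Finset.prod_congr rfl fun i _ => by rw [Set.indicator_of_mem (hy i trivial)]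
    · rw [Set.indicator_of_notMem hy]
      simp only [Set.mem_pi, Set.mem_univ, true_implies, not_forall] at hy
      obtain ⟨i, hi⟩ := hy
      exact (Finset.prod_eq_zero (Finset.mem_univ i) (Set.indicator_of_notMem hi _)).symm
  simp_rw [this]
  have hm : ∀ i, Measurable fun y => ENNReal.ofReal (Real.exp (-r i y)) := fun i =>
    (Real.measurable_exp.comp (hr i).neg).ennreal_ofReal
  rw [lintegral_pi_prod μ fun i => (hm i).indicator (hs i)]
  refine Finset.prod_congr rfl fun i _ => ?_
  rw [h i, withDensity_apply _ (hs i), lintegral_indicator (hs i)]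

/-- Two product measures that agree on the factors in `T` agree on the sets that depend only on
the coordinates in `T`. -/
theorem pi_apply_congr_of_dependsOn {μ ν : ι → Measure Y} [∀ i, IsProbabilityMeasure (μ i)]
    [∀ i, IsProbabilityMeasure (ν i)] (T : Finset ι) (h : ∀ i ∈ T, μ i = ν i)
    {A : Set (ι → Y)} (hA : MeasurableSet A)
    (hdep : ∀ y y' : ι → Y, (∀ i ∈ T, y i = y' i) → (y ∈ A ↔ y' ∈ A)) :
    Measure.pi μ A = Measure.pi ν A := by
  classical
  obtain ⟨y₀⟩ : Nonempty (ι → Y) := (Measure.pi μ).nonempty_of_neZero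
  -- Filling in `y₀` off `T` makes `A` the preimage of `g ⁻¹' A` under restriction to `T`, so only
  -- the marginal on `T` matters.
  let g : (T → Y) → ι → Y := fun z i => if hi : i ∈ T then z ⟨i, hi⟩ else y₀ i
  have hg : Measurable g := by
    refine measurable_pi_lambda _ fun i => ?_
    by_cases hi : i ∈ T
    · simpa [g, hi] using measurable_pi_apply _
    · simp [g, hi]
  have key : ∀ (κ : ι → Measure Y) [∀ i, IsProbabilityMeasure (κ i)],
      Measure.pi κ A = Measure.pi (fun i : T => κ i) (g ⁻¹' A) := by
    intro κ _
    rw [← Measure.infinitePi_map_restrict, Measure.map_apply (by fun_prop) (hg hA),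
      Measure.infinitePi_eq_pi]
    congr 1
    ext y
    exact hdep _ _ fun i hi => by simp [g, hi]
  rw [key μ, key ν]
  congr 2
  ext1 i
  exact h i i.2

variable [DecidableEq ι]

/-- The hybrid measure lets the density involve only the coordinates in `T`, which is what makes the
final exponent scale with `n` rather than `m`. -/
theorem pi_withDensity_on {μ ν : ι → Measure Y} [∀ i, IsProbabilityMeasure (μ i)]
    [∀ i, IsProbabilityMeasure (ν i)] {r : ι → Y → ℝ} (hr : ∀ i, Measurable (r i))
    (h : ∀ i, ν i = (μ i).withDensity fun y => ENNReal.ofReal (Real.exp (-r i y)))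
    (T : Finset ι) :
    Measure.pi (fun i => if i ∈ T then ν i else μ i) =
      (Measure.pi μ).withDensity
        fun y => ENNReal.ofReal (Real.exp (-∑ i ∈ T, r i (y i))) := by
  have : ∀ i, IsProbabilityMeasure (if i ∈ T then ν i else μ i) := fun i => by
    split_ifs <;> infer_instance
  rw [pi_eq_withDensity_exp (μ := μ) (r := fun i y => if i ∈ T then r i y else 0)]
  · simp
  · intro i
    by_cases hi : i ∈ T <;> simp [hi, hr i]
  · intro i
    by_cases hi : i ∈ T
    · simp [hi, h i]
    · simp [hi]

/-- Chernoff's bound for a sum of log-likelihood ratios. -/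
theorem pi_chernoff {μ ν : ι → Measure Y} [∀ i, IsProbabilityMeasure (μ i)]
    [∀ i, IsProbabilityMeasure (ν i)] {r : ι → Y → ℝ} (hr : ∀ i, Measurable (r i))
    (h : ∀ i, ν i = (μ i).withDensity fun y => ENNReal.ofReal (Real.exp (-r i y)))
    (T : Finset ι) (a : ℝ) :
    (Measure.pi μ).real {y | a ≤ -∑ i ∈ T, r i (y i)} ≤ Real.exp (-a) := by
  have : ∀ i, IsProbabilityMeasure (if i ∈ T then ν i else μ i) := fun i => by
    split_ifs <;> infer_instance
  have hm : Measurable fun y : ι → Y => ENNReal.ofReal (Real.exp (-∑ i ∈ T, r i (y i))) := by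
    have : Measurable fun y : ι → Y => ∑ i ∈ T, r i (y i) :=
      Finset.measurable_fun_sum _ fun i _ => (hr i).comp (measurable_pi_apply i)
    exact (Real.measurable_exp.comp this.neg).ennreal_ofReal
  -- The exponential moment is the total mass of the hybrid probability measure, so Markov's
  -- inequality finishes.
  have h1 : ∫⁻ y, ENNReal.ofReal (Real.exp (-∑ i ∈ T, r i (y i))) ∂Measure.pi μ = 1 := by
    have := congrArg (fun κ : Measure (ι → Y) => κ Set.univ) (pi_withDensity_on hr h T)
    simpa using this.symm
  have h2 := mul_meas_ge_le_lintegral (μ := Measure.pi μ) hm (ENNReal.ofReal (Real.exp a))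
  rw [h1] at h2
  have h3 : {y : ι → Y | ENNReal.ofReal (Real.exp a) ≤
      ENNReal.ofReal (Real.exp (-∑ i ∈ T, r i (y i)))} = {y | a ≤ -∑ i ∈ T, r i (y i)} := by
    ext y
    simp [ENNReal.ofReal_le_ofReal_iff (Real.exp_pos _).le]
  rw [h3] at h2
  have h4 := ENNReal.toReal_mono ENNReal.one_ne_top h2
  rw [ENNReal.toReal_mul, ENNReal.toReal_ofReal (Real.exp_pos _).le, ENNReal.toReal_one] at h4
  rw [Real.exp_neg, ← one_div, le_div_iff₀ (Real.exp_pos _), mul_comm]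
  exact h4

/-- Change of measure on the coordinates in `T`. -/
theorem pi_change_of_measure {μ ν : ι → Measure Y} [∀ i, IsProbabilityMeasure (μ i)]
    [∀ i, IsProbabilityMeasure (ν i)] {r : ι → Y → ℝ} (hr : ∀ i, Measurable (r i))
    (h : ∀ i, ν i = (μ i).withDensity fun y => ENNReal.ofReal (Real.exp (-r i y)))
    (T : Finset ι) {A : Set (ι → Y)} (hA : MeasurableSet A)
    (hdep : ∀ y y' : ι → Y, (∀ i ∈ T, y i = y' i) → (y ∈ A ↔ y' ∈ A)) (θ : ℝ) :
    Real.exp (-θ) * ((Measure.pi μ).real A -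
      (Measure.pi μ).real {y | θ < ∑ i ∈ T, r i (y i)}) ≤ (Measure.pi ν).real A := by
  have : ∀ i, IsProbabilityMeasure (if i ∈ T then ν i else μ i) := fun i => by
    split_ifs <;> infer_instance
  have hm : Measurable fun y : ι → Y => ∑ i ∈ T, r i (y i) :=
    Finset.measurable_fun_sum _ fun i _ => (hr i).comp (measurable_pi_apply i)
  set B := {y : ι → Y | θ < ∑ i ∈ T, r i (y i)} with hB
  have hBm : MeasurableSet B := measurableSet_lt measurable_const hm
  -- Since `A` does not see the coordinates off `T`, they may keep the law `μ`.
  have h1 : Measure.pi ν A = Measure.pi (fun i => if i ∈ T then ν i else μ i) A :=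
    pi_apply_congr_of_dependsOn T (fun i hi => by simp [hi]) hA hdep
  have h2 : ENNReal.ofReal (Real.exp (-θ)) * Measure.pi μ (A \ B) ≤ Measure.pi ν A := by
    rw [h1, pi_withDensity_on hr h T, withDensity_apply _ hA]
    calc _ = ∫⁻ _ in A \ B, ENNReal.ofReal (Real.exp (-θ)) ∂Measure.pi μ := by simp
      _ ≤ ∫⁻ y in A \ B, ENNReal.ofReal (Real.exp (-∑ i ∈ T, r i (y i))) ∂Measure.pi μ := by
          refine setLIntegral_mono' (hA.diff hBm) fun y hy => ?_
          have : ∑ i ∈ T, r i (y i) ≤ θ := not_lt.1 hy.2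
          gcongr
      _ ≤ _ := lintegral_mono_set Set.sdiff_subset
  have h3 := ENNReal.toReal_mono (measure_ne_top _ _) h2
  rw [ENNReal.toReal_mul, ENNReal.toReal_ofReal (Real.exp_pos _).le] at h3
  refine le_trans (mul_le_mul_of_nonneg_left ?_ (Real.exp_pos _).le) h3
  exact le_measureReal_sdiff

end Product

/-! ### Growth of balls in graphs of bounded degree -/

section Ball

variable {V : Type*} (G : SimpleGraph V) (v : V)

/-- The vertices at distance exactly `d` from `v`. -/
def sphere (d : ℕ) : Set V := {w | G.Reachable v w ∧ G.dist v w = d}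

/-- The reachability clause in `sphere` is essential: `dist` takes the value 0 between different
components. -/
theorem sphere_zero : sphere G v 0 = {v} := by
  ext w
  simp only [sphere, Set.mem_ofPred_eq, Set.mem_singleton_iff]
  constructor
  · rintro ⟨h, h0⟩
    exact (h.dist_eq_zero_iff.1 h0).symm
  · rintro rfl
    simp

/-- Remove the edge at `w` from a geodesic to `v`. -/
theorem exists_adj_of_mem_sphere_succ {d : ℕ} {w : V} (hw : w ∈ sphere G v (d + 1)) :
    ∃ u ∈ sphere G v d, G.Adj u w := by
  obtain ⟨hr, hd⟩ := hw
  obtain ⟨p, hp⟩ := hr.symm.exists_walk_length_eq_dist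
  rw [G.dist_comm, hd] at hp
  cases p with
  | nil => simp at hp
  | cons h q =>
    rename_i u
    simp only [SimpleGraph.Walk.length_cons, add_left_inj] at hp
    have hru : G.Reachable v u := q.reachable.symm
    refine ⟨u, ⟨hru, le_antisymm ?_ ?_⟩, h.symm⟩
    · rw [← hp, G.dist_comm]; exact SimpleGraph.dist_le q
    · obtain ⟨p', hp'⟩ := hru.exists_walk_length_eq_dist
      have := SimpleGraph.dist_le (p'.concat h.symm)
      rw [SimpleGraph.Walk.length_concat, hd, hp'] at this
      omega

variable [Fintype V] {G} {ζ : ℕ} (hdeg : ∀ w, (G.neighborSet w).ncard ≤ ζ)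
include hdeg

theorem ncard_sphere_one_le : (sphere G v 1).ncard ≤ ζ := by
  refine (Set.ncard_le_ncard ?_ (Set.toFinite _)).trans (hdeg v)
  intro w hw
  obtain ⟨u, hu, huw⟩ := exists_adj_of_mem_sphere_succ G v (d := 0) hw
  rw [sphere_zero] at hu
  rw [Set.mem_singleton_iff.1 hu] at huw
  exact huw

/-- Each `u` at distance `d + 1` has a neighbour at distance `d`, which leaves at most `ζ - 1` edges
leading outwards. -/
theorem ncard_sphere_succ_le (d : ℕ) :
    (sphere G v (d + 2)).ncard ≤ (ζ - 1) * (sphere G v (d + 1)).ncard := by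
  classical
  have hsub : sphere G v (d + 2) ⊆
      ⋃ u ∈ (sphere G v (d + 1)).toFinset, (G.neighborSet u ∩ sphere G v (d + 2)) := by
    intro w hw
    obtain ⟨u, hu, huw⟩ := exists_adj_of_mem_sphere_succ G v hw
    exact Set.mem_biUnion (by simpa using hu) ⟨huw, hw⟩
  calc (sphere G v (d + 2)).ncard
      ≤ (⋃ u ∈ (sphere G v (d + 1)).toFinset,
          (G.neighborSet u ∩ sphere G v (d + 2))).ncard := Set.ncard_le_ncard hsub (Set.toFinite _)
    _ ≤ ∑ u ∈ (sphere G v (d + 1)).toFinset, (G.neighborSet u ∩ sphere G v (d + 2)).ncard :=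
        Finset.set_ncard_biUnion_le _ _
    _ ≤ ∑ u ∈ (sphere G v (d + 1)).toFinset, (ζ - 1) := by
        refine Finset.sum_le_sum fun u hu => ?_
        have hu : u ∈ sphere G v (d + 1) := by simpa using hu
        obtain ⟨t, ht, htu⟩ := exists_adj_of_mem_sphere_succ G v hu
        have htn : t ∈ G.neighborSet u := htu.symm
        have h1 : (G.neighborSet u ∩ sphere G v (d + 2)).ncard ≤
            (G.neighborSet u \ {t}).ncard := by
          refine Set.ncard_le_ncard ?_ (Set.toFinite _)
          rintro w ⟨hw1, hw2⟩
          refine ⟨hw1, ?_⟩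
          rintro rfl
          have := ht.2.symm.trans hw2.2
          omega
        rw [Set.ncard_sdiff_singleton_of_mem htn] at h1
        have := hdeg u
        omega
    _ = _ := by
        rw [Finset.sum_const, smul_eq_mul, mul_comm, Set.ncard_eq_toFinset_card']

theorem ncard_sphere_le (d : ℕ) : (sphere G v (d + 1)).ncard ≤ ζ * (ζ - 1) ^ d := by
  induction d with
  | zero => simpa using ncard_sphere_one_le v hdeg
  | succ d ih =>
    calc _ ≤ (ζ - 1) * (sphere G v (d + 1)).ncard := ncard_sphere_succ_le v hdeg d
      _ ≤ (ζ - 1) * (ζ * (ζ - 1) ^ d) := Nat.mul_le_mul_left _ ih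
      _ = _ := by ring

theorem ncard_ball_le (l : ℕ) :
    {w | ∃ p : G.Walk w v, p.length ≤ l}.ncard ≤ 1 + ζ * ∑ d ∈ Finset.range l, (ζ - 1) ^ d := by
  induction l with
  | zero =>
    have : {w | ∃ p : G.Walk w v, p.length ≤ 0} = {v} := by
      ext w
      constructor
      · rintro ⟨p, hp⟩
        exact SimpleGraph.Walk.eq_of_length_eq_zero (Nat.le_zero.1 hp)
      · rintro rfl
        exact ⟨.nil, le_rfl⟩
    rw [this]
    simp
  | succ l ih =>
    have hsub : {w | ∃ p : G.Walk w v, p.length ≤ l + 1} ⊆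
        {w | ∃ p : G.Walk w v, p.length ≤ l} ∪ sphere G v (l + 1) := by
      rintro w ⟨p, hp⟩
      have hr : G.Reachable v w := p.reachable.symm
      by_cases hd : G.dist v w = l + 1
      · exact .inr ⟨hr, hd⟩
      · refine .inl ?_
        obtain ⟨q, hq⟩ := hr.symm.exists_walk_length_eq_dist
        have := SimpleGraph.dist_le p
        rw [G.dist_comm] at hd
        exact ⟨q, by omega⟩
    calc _ ≤ _ := Set.ncard_le_ncard hsub (Set.toFinite _)
      _ ≤ _ := Set.ncard_union_le _ _
      _ ≤ _ := add_le_add ih (ncard_sphere_le v hdeg l)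
      _ = _ := by rw [Finset.sum_range_succ]; ring

end Ball

/-! ### Iterations and power -/

namespace Decoder

variable {Y V S M : Type*} {k m ζ : ℕ} (D : Decoder Y V S M k m ζ)

theorem nbdSize_le_card (i : Fin k) : D.nbdSize i ≤ m := by
  have := Set.ncard_le_card {j : Fin m |
    ∃ w : D.graph.Walk (D.outputPE j) (D.messagePE i), w.length ≤ D.iterations}
  simpa [nbdSize] using this

theorem maxNbdSize_le_card : D.maxNbdSize ≤ m :=
  Finset.sup_le fun i _ => D.nbdSize_le_card i

variable [Fintype V]

/-- Injectivity of `outputPE` embeds each neighbourhood into a ball around the message PE. -/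
theorem maxNbdSize_le_geom :
    D.maxNbdSize ≤ 1 + ζ * ∑ d ∈ Finset.range D.iterations, (ζ - 1) ^ d := by
  refine Finset.sup_le fun i _ => ?_
  refine le_trans ?_ (ncard_ball_le (D.messagePE i) D.neighbours_le D.iterations)
  exact Set.ncard_le_ncard_of_injOn D.outputPE (fun j hj => hj) D.outputPE_injective.injOn
    (Set.toFinite _)

theorem le_decodingEnergy {Enode : ℝ} (hE : 0 ≤ Enode) :
    Enode * m * D.iterations ≤ D.decodingEnergy Enode := by
  have : m ≤ Fintype.card V := by
    simpa using Fintype.card_le_of_injective _ D.outputPE_injective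
  unfold decodingEnergy
  gcongr

theorem maxNbdSize_le (hζ : 2 < ζ) :
    (D.maxNbdSize : ℝ) ≤
      ζ * ((((ζ : ℝ) - 1) ^ D.iterations - 1) / ((ζ : ℝ) - 2)) + 1 := by
  have h : (2 : ℝ) < ζ := by exact_mod_cast hζ
  have h1 : (D.maxNbdSize : ℝ) ≤
      1 + ζ * ∑ d ∈ Finset.range D.iterations, ((ζ - 1 : ℕ) : ℝ) ^ d := by
    exact_mod_cast D.maxNbdSize_le_geom
  rw [Nat.cast_sub (by omega), Nat.cast_one, geom_sum_eq (by linarith)] at h1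
  have h2 : (ζ : ℝ) - 1 - 1 = ζ - 2 := by ring
  rw [h2] at h1
  linarith

theorem maxNbdSize_le_of_two (hζ : ζ = 2) : D.maxNbdSize ≤ 2 * D.iterations + 1 := by
  have := D.maxNbdSize_le_geom
  subst hζ
  simp at this
  omega

theorem log_le_iterations (hζ : 2 < ζ) :
    Real.log (((ζ : ℝ) - 2) / ζ * D.maxNbdSize + 2 / ζ) / Real.log ((ζ : ℝ) - 1) ≤
      D.iterations := by
  have h : (2 : ℝ) < ζ := by exact_mod_cast hζ
  have h0 : (0 : ℝ) < (ζ - 2) / ζ := div_pos (by linarith) (by linarith)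
  rw [div_le_iff₀ (Real.log_pos (by linarith)), ← Real.log_pow]
  refine Real.log_le_log (by positivity) ?_
  have h1 := mul_le_mul_of_nonneg_left (D.maxNbdSize_le hζ) h0.le
  -- The affine expression inside the logarithm inverts the geometric-sum bound on `n`.
  have h2 : ((ζ : ℝ) - 2) / ζ *
      (ζ * ((((ζ : ℝ) - 1) ^ D.iterations - 1) / ((ζ : ℝ) - 2)) + 1) + 2 / ζ =
      ((ζ : ℝ) - 1) ^ D.iterations := by
    have : (ζ : ℝ) - 2 ≠ 0 := by linarith
    field_simp
    ring
  linarith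

theorem totalPowerBound_le {ξT ξD PR Enode Rdec : ℝ} (hξD : 0 < ξD)
    (hEnode : 0 < Enode) (hRdec : 0 < Rdec) (hk : 0 < k) (hm : 0 < m) (hζ : 2 < ζ) :
    totalPowerBound ξT ξD PR Enode Rdec ((k : ℝ) / m) ζ D.maxNbdSize ≤
      D.totalPower ξT ξD PR Enode Rdec := by
  have h : (2 : ℝ) < ζ := by exact_mod_cast hζ
  have hk' : (0 : ℝ) < k := by exact_mod_cast hk
  have hm' : (0 : ℝ) < m := by exact_mod_cast hm
  unfold totalPowerBound totalPower decodingPower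
  have hlog : 0 < Real.log ((ζ : ℝ) - 1) := Real.log_pos (by linarith)
  -- The positive part costs nothing since `iterations` is nonnegative; it matters at `n = 0`, where
  -- the logarithm is negative.
  have h1 : max 0 (Real.log (((ζ : ℝ) - 2) / ζ * D.maxNbdSize + 2 / ζ)) /
      Real.log ((ζ : ℝ) - 1) ≤ D.iterations := by
    rw [div_le_iff₀ hlog]
    refine max_le (by positivity) ?_
    rw [← div_le_iff₀ hlog]
    exact D.log_le_iterations hζ
  have h2 := D.le_decodingEnergy hEnode.le
  calc _ ≤ ξT * PR + ξD * Enode * Rdec / (k / m) * D.iterations := by gcongr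
    _ = ξT * PR + ξD * ((Enode * m * D.iterations) / (k / Rdec)) := by
        field_simp
    _ ≤ _ := by gcongr

end Decoder

theorem totalPowerBound_mono {ξT ξD PR Enode Rdec Rch : ℝ} {ζ : ℕ} (hξD : 0 ≤ ξD)
    (hEnode : 0 ≤ Enode) (hRdec : 0 ≤ Rdec) (hRch : 0 ≤ Rch) (hζ : 2 < ζ) :
    Monotone (totalPowerBound ξT ξD PR Enode Rdec Rch ζ) := by
  intro n n' hn
  have h : (2 : ℝ) < ζ := by exact_mod_cast hζ
  have h0 : (0 : ℝ) < (ζ - 2) / ζ := div_pos (by linarith) (by linarith)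
  have hlog : 0 < Real.log ((ζ : ℝ) - 1) := Real.log_pos (by linarith)
  unfold totalPowerBound
  gcongr

/-- A lower bound that holds at the neighbourhood size of a decoder transfers to the
neighbourhood size required for a target error probability. -/
theorem power_of_spherePacking {Y V S M : Type*} [Fintype V] {k m ζ : ℕ} (hk : 0 < k)
    (hm : 0 < m) {ξT ξD PR Enode Rdec : ℝ} (hξD : 0 < ξD) (hEnode : 0 < Enode)
    (hRdec : 0 < Rdec) (D : Decoder Y V S M k m ζ) {B : ℕ → EReal} {P Pe : ℝ}
    (hB : B D.maxNbdSize ≤ (P : EReal)) (hP : P ≤ Pe) :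
    requiredNbd B Pe ≤ D.maxNbdSize ∧
      (2 < ζ → totalPowerBound ξT ξD PR Enode Rdec ((k : ℝ) / m) ζ (requiredNbd B Pe) ≤
        D.totalPower ξT ξD PR Enode Rdec) := by
  have h1 : requiredNbd B Pe ≤ D.maxNbdSize :=
    -- The actual neighbourhood size belongs to the set, so the default value of `sInf ∅` plays no
    -- role.
    Nat.sInf_le (hB.trans (EReal.coe_le_coe_iff.2 hP))
  exact ⟨h1, fun hζ => (totalPowerBound_mono hξD.le hEnode.le hRdec.le (by positivity) hζ h1).trans
    (D.totalPowerBound_le hξD hEnode hRdec hk hm hζ)⟩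

/-! ### The binary entropy function and its inverse -/

theorem exists_hb_eq {δ : ℝ} (h0 : 0 ≤ δ) (h1 : δ ≤ 1) :
    ∃ x ∈ Set.Icc (0 : ℝ) (1 / 2), hb x = δ := by
  have hc : ContinuousOn hb (Set.Icc 0 (1 / 2)) :=
    (Real.binEntropy_continuous.div_const _).continuousOn
  have h := intermediate_value_Icc (by norm_num) hc
  have e0 : hb 0 = 0 := by simp [hb]
  have e1 : hb (1 / 2) = 1 := by
    rw [hb, one_div, Real.binEntropy_two_inv, div_self (Real.log_pos one_lt_two).ne']
  rw [e0, e1] at h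
  exact h ⟨h0, h1⟩

theorem hbInv_mem {δ : ℝ} (h0 : 0 ≤ δ) (h1 : δ ≤ 1) : hbInv δ ∈ Set.Icc (0 : ℝ) (1 / 2) :=
  Function.invFunOn_mem (exists_hb_eq h0 h1)

theorem hb_hbInv {δ : ℝ} (h0 : 0 ≤ δ) (h1 : δ ≤ 1) : hb (hbInv δ) = δ :=
  Function.invFunOn_eq (exists_hb_eq h0 h1)

theorem hbInv_pos {δ : ℝ} (h0 : 0 < δ) (h1 : δ ≤ 1) : 0 < hbInv δ := by
  refine lt_of_le_of_ne (hbInv_mem h0.le h1).1 fun h => ?_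
  have := hb_hbInv h0.le h1
  rw [← h] at this
  simp [hb] at this
  exact h0.ne this

/-- If coding at the error rate `P` with every mismatched parameter `q` costs at least `δ` bits,
then `P` is at least `h_b⁻¹(δ)`. -/
theorem hbInv_le_of_forall_cross_entropy {δ P : ℝ} (h0 : 0 < δ) (h1 : δ ≤ 1) (hP : 0 ≤ P)
    (h : ∀ q, 0 < q → q < 1 →
      δ * Real.log 2 ≤ -(P * Real.log q + (1 - P) * Real.log (1 - q))) :
    hbInv δ ≤ P := by
  have hlog : 0 < Real.log 2 := Real.log_pos one_lt_two
  obtain ⟨hx0, hx1⟩ := hbInv_mem h0.le h1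
  by_contra! hlt
  rcases hP.eq_or_lt with rfl | hP
  · have hd : 0 < δ * Real.log 2 := mul_pos h0 hlog
    have he : Real.exp (-(δ * Real.log 2 / 2)) < 1 := by
      rw [Real.exp_lt_one_iff]; linarith
    -- At `P = 0` the choice `q = P` is not allowed; this small `q` has cost only `δ * log 2 / 2`.
    have := h (1 - Real.exp (-(δ * Real.log 2 / 2))) (by linarith)
      (by linarith [Real.exp_pos (-(δ * Real.log 2 / 2))])
    simp only [sub_sub_cancel, Real.log_exp] at this
    linarith
  · have h2 := h P hP (by linarith)
    have h3 : Real.binEntropy P < Real.binEntropy (hbInv δ) :=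
      Real.binEntropy_strictMonoOn ⟨hP.le, by linarith⟩ ⟨hx0, by linarith⟩ hlt
    have h4 : Real.binEntropy (hbInv δ) = δ * Real.log 2 := by
      rw [← div_eq_iff hlog.ne']
      exact hb_hbInv h0.le h1
    rw [h4, Real.binEntropy_eq_negMulLog_add_negMulLog_one_sub, Real.negMulLog,
      Real.negMulLog] at h3
    linarith

/-! ### Locality of decoding -/

namespace Decoder

variable {Y V S M : Type*} {k m ζ : ℕ} (D : Decoder Y V S M k m ζ)

theorem stored_congr {y y' : Fin m → Y} {v : V}
    (h : ∀ j, D.outputPE j = v → y j = y' j) : D.stored y v = D.stored y' v := by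
  unfold stored
  by_cases hv : ∃ j, D.outputPE j = v
  · obtain ⟨j, rfl⟩ := hv
    rw [D.outputPE_injective.extend_apply, D.outputPE_injective.extend_apply, h j rfl]
  · rw [Function.extend_apply' _ _ _ hv, Function.extend_apply' _ _ _ hv]

/-- Information travels one edge per iteration: a walk to the neighbour `w` extends by the edge over
which its message arrives. -/
theorem state_congr {y y' : Fin m → Y} (t : ℕ) {v : V}
    (h : ∀ j, (∃ w : D.graph.Walk (D.outputPE j) v, w.length ≤ t) → y j = y' j) :
    D.state y t v = D.state y' t v := by
  induction t generalizing v with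
  | zero =>
    rw [state, state, D.stored_congr]
    rintro j rfl
    exact h j ⟨.nil, le_rfl⟩
  | succ t ih =>
    rw [state, state, ih fun j ⟨w, hw⟩ => h j ⟨w, by omega⟩]
    congr 1
    funext w
    rw [ih fun j ⟨p, hp⟩ => h j ⟨p.concat w.2.symm, by
      rw [SimpleGraph.Walk.length_concat]; omega⟩]

theorem decode_congr {y y' : Fin m → Y} {i : Fin k}
    (h : ∀ j, (∃ w : D.graph.Walk (D.outputPE j) (D.messagePE i), w.length ≤ D.iterations) →
      y j = y' j) :
    D.decode y i = D.decode y' i := by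
  rw [decode, decode, D.state_congr _ h]

/-- Every decoded bit is a function of `maxNbdSize` channel outputs. -/
theorem exists_finset_decode_congr (i : Fin k) :
    ∃ T : Finset (Fin m), T.card = D.maxNbdSize ∧
      ∀ y y' : Fin m → Y, (∀ j ∈ T, y j = y' j) → D.decode y i = D.decode y' i := by
  classical
  let N : Finset (Fin m) := {j : Fin m |
    ∃ w : D.graph.Walk (D.outputPE j) (D.messagePE i), w.length ≤ D.iterations}.toFinset
  have hN : N.card ≤ D.maxNbdSize := by
    refine le_trans (le_of_eq ?_) (Finset.le_sup (f := D.nbdSize) (Finset.mem_univ i))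
    exact (Set.ncard_eq_toFinset_card' _).symm
  -- Padding to exactly `maxNbdSize` outputs lets one threshold `θ` serve all bits.
  obtain ⟨T, hT, hcard⟩ := Finset.exists_superset_card_eq hN
    (by simpa using D.maxNbdSize_le_card)
  refine ⟨T, hcard, fun y y' h => D.decode_congr fun j hj => h j (hT ?_)⟩
  simpa [N] using hj

end Decoder

/-! ### Fano's inequality for the average bit-error probability -/

section Fano

variable {X Y V S M : Type*} [MeasurableSpace Y] {k m ζ : ℕ}

/-- Up to the factor `2 ^ k`, the product is a probability law on messages: each bit differs from `c
i` independently with probability `q`. -/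
theorem sum_bool_prod_guess (c : Fin k → Bool) (q : ℝ) :
    ∑ b : Fin k → Bool, ∏ i, (2 * if c i ≠ b i then q else 1 - q) = 2 ^ k := by
  have := Finset.prod_univ_sum (fun _ : Fin k => (Finset.univ : Finset Bool))
    (fun i b => 2 * if c i ≠ b then q else 1 - q)
  rw [Fintype.piFinset_univ] at this
  rw [← this]
  have h : ∀ i, ∑ b : Bool, (2 * if c i ≠ b then q else 1 - q) = 2 := by
    intro i
    cases c i <;> simp <;> ring
  simp_rw [h]
  simp

variable (W : X → Measure Y) (enc : (Fin k → Bool) → Fin m → X) (D : Decoder Y V S M k m ζ)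

theorem avgErrorProb_nonneg : 0 ≤ avgErrorProb W enc D := by
  unfold avgErrorProb bitErrorProb
  positivity

theorem avgErrorProb_eq :
    avgErrorProb W enc D = (∑ b, ∑ i,
      (Measure.pi fun j => W (enc b j)).real {y | D.decode y i ≠ b i}) / (2 ^ k * k) := by
  unfold avgErrorProb bitErrorProb
  rw [Finset.sum_comm, ← Finset.sum_div, div_div]

theorem measurableSet_decode_ne (hD : ∀ i, Measurable fun y => D.decode y i) (i : Fin k)
    (b : Bool) : MeasurableSet {y | D.decode y i ≠ b} :=
  (hD i) (measurableSet_singleton b).compl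

variable [∀ x, IsProbabilityMeasure (W x)]

/-- One message: the log-likelihood of the guess `F b y = ∏ i, 2 (q or 1 - q)` against the
information cost of the codeword. -/
theorem sum_log_guess_le {Q : Measure Y} [IsProbabilityMeasure Q] {ℓ : X → Y → ℝ}
    (hℓ : ∀ x, Measurable (ℓ x)) (hint : ∀ x, Integrable (ℓ x) (W x))
    (hQ : ∀ x, Q = (W x).withDensity fun y => ENNReal.ofReal (Real.exp (-ℓ x y)))
    (hD : ∀ i, Measurable fun y => D.decode y i) {q : ℝ} (hq0 : 0 < q) (hq1 : q < 1)
    (b : Fin k → Bool) :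
    k * Real.log 2 + ∑ i,
        ((Measure.pi fun j => W (enc b j)).real {y | D.decode y i ≠ b i} * Real.log q +
          (1 - (Measure.pi fun j => W (enc b j)).real {y | D.decode y i ≠ b i}) *
            Real.log (1 - q)) -
      ∑ j, ∫ y, ℓ (enc b j) y ∂W (enc b j) ≤
    ∫ y, (∏ i, (2 * if D.decode y i ≠ b i then q else 1 - q)) ∂(Measure.pi fun _ : Fin m => Q)
      - 1 := by
  set P := Measure.pi fun j => W (enc b j) with hP
  set F : (Fin m → Y) → ℝ := fun y => ∏ i, (2 * if D.decode y i ≠ b i then q else 1 - q) with hF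
  set L : (Fin m → Y) → ℝ := fun y => ∑ j, ℓ (enc b j) (y j) with hL
  have hset : ∀ i, MeasurableSet {y | D.decode y i ≠ b i} := fun i =>
    measurableSet_decode_ne D hD i (b i)
  have hFpos : ∀ y, 0 < F y := fun y => Finset.prod_pos fun i _ => by
    split_ifs <;> linarith
  have hFle : ∀ y, F y ≤ ∏ _i : Fin k, (2 : ℝ) := fun y =>
    Finset.prod_le_prod (fun i _ => by split_ifs <;> linarith)
      fun i _ => by split_ifs <;> linarith
  have hFm : Measurable F := Finset.measurable_fun_prod _ fun i _ =>
    measurable_const.mul (Measurable.ite (hset i) measurable_const measurable_const)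
  have hLm : Measurable L := Finset.measurable_fun_sum _ fun j _ =>
    (hℓ _).comp (measurable_pi_apply j)
  have hLi : Integrable L P := integrable_finsetSum _ fun j _ =>
    integrable_comp_eval (hint (enc b j))
  have hpi : (Measure.pi fun _ : Fin m => Q) =
      P.withDensity fun y => ENNReal.ofReal (Real.exp (-L y)) :=
    pi_eq_withDensity_exp (fun j => hℓ (enc b j)) fun j => hQ (enc b j)
  have hdm : Measurable fun y => ENNReal.ofReal (Real.exp (-L y)) :=
    (Real.measurable_exp.comp hLm.neg).ennreal_ofReal
  have hFQ : Integrable F (Measure.pi fun _ : Fin m => Q) :=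
    Integrable.of_bound hFm.aestronglyMeasurable (∏ _i : Fin k, (2 : ℝ))
      (Filter.Eventually.of_forall fun y => by
        rw [Real.norm_of_nonneg (hFpos y).le]; exact hFle y)
  have hFP : Integrable (fun y => Real.exp (-L y) * F y) P := by
    rw [hpi, integrable_withDensity_iff_integrable_smul' hdm (by simp)] at hFQ
    simpa [ENNReal.toReal_ofReal, (Real.exp_pos _).le] using hFQ
  have hchange : ∫ y, F y ∂(Measure.pi fun _ : Fin m => Q) = ∫ y, Real.exp (-L y) * F y ∂P := by
    rw [hpi, integral_withDensity_eq_integral_toReal_smul hdm (by simp)]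
    simp [ENNReal.toReal_ofReal, (Real.exp_pos _).le]
  have hlogF : ∀ y, Real.log (F y) = ∑ i, (Real.log 2 +
      ({y | D.decode y i ≠ b i}.indicator (fun _ => Real.log q - Real.log (1 - q)) y
        + Real.log (1 - q))) := by
    intro y
    rw [hF, Real.log_prod fun i _ => ?_]
    · refine Finset.sum_congr rfl fun i _ => ?_
      by_cases hi : D.decode y i ≠ b i
      · simp [Set.indicator, hi, Real.log_mul, hq0.ne']
      · have : (1 - q) ≠ 0 := by linarith
        simp [Set.indicator, hi, Real.log_mul, this]
    · split_ifs <;> [exact (by linarith : (0 : ℝ) < 2 * q).ne';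
        exact (by linarith : (0 : ℝ) < 2 * (1 - q)).ne']
  have hii : ∀ i, Integrable (fun y => Real.log 2 +
      ({y | D.decode y i ≠ b i}.indicator (fun _ => Real.log q - Real.log (1 - q)) y
        + Real.log (1 - q))) P := fun i =>
    (integrable_const _).add (((integrable_const _).indicator (hset i)).add (integrable_const _))
  have hlogFi : Integrable (fun y => Real.log (F y)) P := by
    simp_rw [hlogF]
    exact integrable_finsetSum _ fun i _ => hii i
  have hlogFint : ∫ y, Real.log (F y) ∂P = k * Real.log 2 + ∑ i,
      (P.real {y | D.decode y i ≠ b i} * Real.log q +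
        (1 - P.real {y | D.decode y i ≠ b i}) * Real.log (1 - q)) := by
    simp_rw [hlogF]
    rw [integral_finsetSum _ fun i _ => hii i]
    have : ∀ i, ∫ y, (Real.log 2 +
        ({y | D.decode y i ≠ b i}.indicator (fun _ => Real.log q - Real.log (1 - q)) y
          + Real.log (1 - q))) ∂P = Real.log 2 + (P.real {y | D.decode y i ≠ b i} * Real.log q +
        (1 - P.real {y | D.decode y i ≠ b i}) * Real.log (1 - q)) := by
      intro i
      rw [integral_add (integrable_const _)
        (((integrable_const _).indicator (hset i)).add (integrable_const _)),
        integral_add ((integrable_const _).indicator (hset i)) (integrable_const _),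
        integral_indicator_const _ (hset i)]
      simp
      ring
    simp_rw [this, Finset.sum_add_distrib]
    simp
  have hLint : ∫ y, L y ∂P = ∑ j, ∫ y, ℓ (enc b j) y ∂W (enc b j) := by
    rw [hL, integral_finsetSum _ fun j _ => integrable_comp_eval (hint (enc b j))]
    exact Finset.sum_congr rfl fun j _ =>
      integral_comp_eval (μ := fun j => W (enc b j)) (hℓ (enc b j)).aestronglyMeasurable
  rw [← hlogFint, ← hLint, ← integral_sub hlogFi hLi, hchange]
  have h1 : (1 : ℝ) = ∫ _, (1 : ℝ) ∂P := by simp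
  rw [h1, ← integral_sub hFP (integrable_const _)]
  refine integral_mono (hlogFi.sub hLi) (hFP.sub (integrable_const _)) fun y => ?_
  -- Here `log t ≤ t - 1` with `t = exp (-L) * F`, whose `P`-integral is the integral of `F` under
  -- the product of `Q`.
  have := Real.log_le_sub_one_of_pos (mul_pos (Real.exp_pos (-L y)) (hFpos y))
  rw [Real.log_mul (Real.exp_pos _).ne' (hFpos y).ne', Real.log_exp] at this
  simp only
  linarith

/-- Because the law `Q` is the same for all messages, the integrals of the guesses add up to `2 ^
k`, which cancels the `-1` terms. -/
theorem fano_cross_entropy {Q : Measure Y} [IsProbabilityMeasure Q] {ℓ : X → Y → ℝ}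
    (hk : 0 < k) (hℓ : ∀ x, Measurable (ℓ x)) (hint : ∀ x, Integrable (ℓ x) (W x))
    (hQ : ∀ x, Q = (W x).withDensity fun y => ENNReal.ofReal (Real.exp (-ℓ x y)))
    (hD : ∀ i, Measurable fun y => D.decode y i) {q : ℝ} (hq0 : 0 < q) (hq1 : q < 1) :
    k * (Real.log 2 + (avgErrorProb W enc D * Real.log q +
        (1 - avgErrorProb W enc D) * Real.log (1 - q))) ≤
      (∑ b, ∑ j, ∫ y, ℓ (enc b j) y ∂W (enc b j)) / 2 ^ k := by
  have h := Finset.sum_le_sum fun b (_ : b ∈ Finset.univ) =>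
    sum_log_guess_le W enc D hℓ hint hQ hD hq0 hq1 b
  rw [Finset.sum_sub_distrib, Finset.sum_sub_distrib, ← integral_finsetSum] at h
  · simp_rw [sum_bool_prod_guess] at h
    rw [le_div_iff₀ (by positivity), avgErrorProb_eq]
    have hk' : (k : ℝ) ≠ 0 := by positivity
    simp only [Finset.sum_add_distrib, Finset.sum_sub_distrib, sub_mul, one_mul,
      Finset.sum_const, Finset.card_univ, Fintype.card_fun, Fintype.card_bool, Fintype.card_fin,
      integral_const, smul_eq_mul, probReal_univ, nsmul_eq_mul, ← Finset.sum_mul] at h ⊢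
    push_cast at h
    field_simp
    linarith
  · intro b _
    refine Integrable.of_bound (Measurable.aestronglyMeasurable ?_) (∏ _i : Fin k, (2 : ℝ))
      (Filter.Eventually.of_forall fun y => ?_)
    · exact Finset.measurable_fun_prod _ fun i _ => measurable_const.mul
        (Measurable.ite (measurableSet_decode_ne D hD i (b i)) measurable_const measurable_const)
    · rw [Real.norm_of_nonneg (Finset.prod_nonneg fun i _ => by split_ifs <;> linarith)]
      exact Finset.prod_le_prod (fun i _ => by split_ifs <;> linarith)
        fun i _ => by split_ifs <;> linarith

/-- Fano's inequality: `C` bounds the information per channel use, in bits. -/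
theorem hbInv_le_avgErrorProb {Q : Measure Y} [IsProbabilityMeasure Q] {ℓ : X → Y → ℝ} {C : ℝ}
    (hk : 0 < k) (hm : 0 < m) (hC0 : 0 ≤ C) (hC : C < (k : ℝ) / m)
    (hℓ : ∀ x, Measurable (ℓ x)) (hint : ∀ x, Integrable (ℓ x) (W x))
    (hQ : ∀ x, Q = (W x).withDensity fun y => ENNReal.ofReal (Real.exp (-ℓ x y)))
    (hI : (∑ b, ∑ j, ∫ y, ℓ (enc b j) y ∂W (enc b j)) / 2 ^ k ≤ m * (C * Real.log 2))
    (hD : ∀ i, Measurable fun y => D.decode y i) :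
    hbInv (1 - C / ((k : ℝ) / m)) ≤ avgErrorProb W enc D := by
  have hk' : (0 : ℝ) < k := by exact_mod_cast hk
  have hm' : (0 : ℝ) < m := by exact_mod_cast hm
  have hR : (0 : ℝ) < (k : ℝ) / m := by positivity
  have hle := (div_lt_one hR).2 hC
  refine hbInv_le_of_forall_cross_entropy (by linarith) (by linarith [div_nonneg hC0 hR.le])
    (avgErrorProb_nonneg W enc D) fun q hq0 hq1 => ?_
  have h := (fano_cross_entropy W enc D hk hℓ hint hQ hD hq0 hq1).trans hI
  have h2 : k * ((1 - C / ((k : ℝ) / m)) * Real.log 2) =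
      k * Real.log 2 - m * (C * Real.log 2) := by
    field_simp
  refine le_of_mul_le_mul_left ?_ hk'
  rw [h2]
  linarith

end Fano

/-! ### Local sphere packing for a pair of channels -/

section SpherePacking

variable {X Y V S M : Type*} [MeasurableSpace Y] {k m ζ : ℕ}

/-- If the noise of the test channel `W'` is typical up to probability `x / 2` on every set of
`maxNbdSize` channel outputs, and decoding behind `W'` has average bit-error probability at least
`x`, then the error probability behind `W` is at least `exp (-θ) * x / 2`. -/
theorem avgErrorProb_ge_of_test_channel (W W' : X → Measure Y)
    [∀ x, IsProbabilityMeasure (W x)] [∀ x, IsProbabilityMeasure (W' x)]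
    (enc : (Fin k → Bool) → Fin m → X) (D : Decoder Y V S M k m ζ) (hk : 0 < k)
    (hD : ∀ i, Measurable fun y => D.decode y i) {r : X → Y → ℝ}
    (hr : ∀ x, Measurable (r x))
    (h : ∀ x, W x = (W' x).withDensity fun y => ENNReal.ofReal (Real.exp (-r x y)))
    {θ x : ℝ} (hx : x ≤ avgErrorProb W' enc D)
    (htyp : ∀ (c : Fin m → X) (T : Finset (Fin m)), T.card = D.maxNbdSize →
      (Measure.pi fun j => W' (c j)).real {y | θ < ∑ j ∈ T, r (c j) (y j)} ≤ x / 2) :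
    Real.exp (-θ) * (x / 2) ≤ avgErrorProb W enc D := by
  have hk' : (0 : ℝ) < k := by exact_mod_cast hk
  have key : ∀ b i, Real.exp (-θ) *
      ((Measure.pi fun j => W' (enc b j)).real {y | D.decode y i ≠ b i} - x / 2) ≤
      (Measure.pi fun j => W (enc b j)).real {y | D.decode y i ≠ b i} := by
    intro b i
    obtain ⟨T, hT, hdep⟩ := D.exists_finset_decode_congr i
    have h1 := pi_change_of_measure (μ := fun j => W' (enc b j)) (ν := fun j => W (enc b j))
      (r := fun j => r (enc b j)) (fun j => hr _) (fun j => h _) T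
      (measurableSet_decode_ne D hD i (b i))
      (fun y y' hy => by simp [hdep y y' hy]) θ
    refine le_trans (mul_le_mul_of_nonneg_left ?_ (Real.exp_pos _).le) h1
    linarith [htyp (enc b) T hT]
  -- The bound `key` is affine in the error probability with a common `θ`, so plain averaging
  -- suffices and no convexity is needed.
  have hsum := Finset.sum_le_sum fun b (_ : b ∈ (Finset.univ : Finset (Fin k → Bool))) =>
    Finset.sum_le_sum fun i (_ : i ∈ (Finset.univ : Finset (Fin k))) => key b i
  rw [avgErrorProb_eq] at hx ⊢
  rw [le_div_iff₀ (by positivity)] at hx ⊢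
  refine le_trans ?_ hsum
  simp_rw [← Finset.mul_sum, Finset.sum_sub_distrib]
  simp only [Finset.sum_const, Finset.card_univ, Fintype.card_fun, Fintype.card_bool,
    Fintype.card_fin, nsmul_eq_mul]
  push_cast
  rw [mul_assoc]
  refine mul_le_mul_of_nonneg_left ?_ (Real.exp_pos _).le
  linarith

end SpherePacking

/-! ### The binary symmetric channel -/

theorem isProbabilityMeasure_bsc {p : ℝ} (h0 : 0 ≤ p) (h1 : p ≤ 1) (x : Bool) :
    IsProbabilityMeasure (bsc p x) := by
  constructor
  simp only [bsc, Measure.coe_add, Measure.coe_smul, Pi.add_apply, Pi.smul_apply, measure_univ,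
    smul_eq_mul, mul_one]
  rw [← ENNReal.ofReal_add (by linarith) h0]
  simp

theorem bsc_singleton (p : ℝ) (x y : Bool) :
    bsc p x {y} = ENNReal.ofReal (if y = x then 1 - p else p) := by
  cases x <;> cases y <;> simp [bsc]

/-- The log-likelihood ratio of the channels `bsc g` and `bsc a`. -/
def llrBSC (g a : ℝ) (x y : Bool) : ℝ :=
  if y = x then Real.log ((1 - g) / (1 - a)) else Real.log (g / a)

theorem bsc_eq_withDensity {g a : ℝ} (hg0 : 0 < g) (hg1 : g < 1) (ha0 : 0 < a) (ha1 : a < 1)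
    (x : Bool) :
    bsc a x = (bsc g x).withDensity fun y => ENNReal.ofReal (Real.exp (-llrBSC g a x y)) := by
  refine Measure.ext_of_singleton fun y => ?_
  rw [withDensity_apply _ (measurableSet_singleton y), lintegral_singleton, bsc_singleton,
    bsc_singleton, ← ENNReal.ofReal_mul (Real.exp_pos _).le]
  congr 1
  have h1 : 0 < 1 - g := by linarith
  have h2 : 0 < 1 - a := by linarith
  unfold llrBSC
  split_ifs
  · rw [← Real.log_inv, Real.exp_log (by positivity), inv_div, div_mul_cancel₀ _ h1.ne']
  · rw [← Real.log_inv, Real.exp_log (by positivity), inv_div, div_mul_cancel₀ _ hg0.ne']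

/-- The uniform law is the input-independent output law `Q` in Fano's inequality for the BSC. -/
theorem bsc_half_eq (x x' : Bool) : bsc (1 / 2) x = bsc (1 / 2) x' := by
  refine Measure.ext_of_singleton fun y => ?_
  rw [bsc_singleton, bsc_singleton]
  norm_num

theorem sum_llrBSC {m : ℕ} (g a : ℝ) (c y : Fin m → Bool) (T : Finset (Fin m)) :
    ∑ j ∈ T, llrBSC g a (c j) (y j) =
      T.card * Real.log ((1 - g) / (1 - a)) + (T.filter fun j => y j ≠ c j).card *
        (Real.log (g / a) - Real.log ((1 - g) / (1 - a))) := by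
  have : ∀ j, llrBSC g a (c j) (y j) = Real.log ((1 - g) / (1 - a)) +
      if y j ≠ c j then Real.log (g / a) - Real.log ((1 - g) / (1 - a)) else 0 := by
    intro j
    unfold llrBSC
    split_ifs <;> simp_all
  simp_rw [this, Finset.sum_add_distrib, ← Finset.sum_filter]
  simp [mul_sub]

theorem integral_llrBSC_half {g : ℝ} (hg0 : 0 < g) (hg1 : g < 1) (x : Bool) :
    ∫ y, llrBSC g (1 / 2) x y ∂bsc g x = capBSC g * Real.log 2 := by
  have : IsProbabilityMeasure (bsc g x) := isProbabilityMeasure_bsc hg0.le hg1.le x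
  have h1 : 0 < 1 - g := by linarith
  have hlog : Real.log 2 ≠ 0 := (Real.log_pos one_lt_two).ne'
  rw [integral_fintype .of_finite]
  have e1 : Real.log ((1 - g) / (1 - 1 / 2)) = Real.log (1 - g) + Real.log 2 := by
    rw [← Real.log_mul h1.ne' two_ne_zero]; congr 1; ring
  have e2 : Real.log (g / (1 / 2)) = Real.log g + Real.log 2 := by
    rw [← Real.log_mul hg0.ne' two_ne_zero]; congr 1; ring
  simp only [measureReal_def, bsc_singleton, llrBSC, e1, e2, Fintype.sum_bool, capBSC, hb,
    Real.binEntropy_eq_negMulLog_add_negMulLog_one_sub, Real.negMulLog]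
  cases x <;> simp [ENNReal.toReal_ofReal, hg0.le, h1.le] <;> field_simp <;> ring

theorem divBSC_mul_log_two (g p : ℝ) :
    divBSC g p * Real.log 2 =
      g * Real.log (g / p) + (1 - g) * Real.log ((1 - g) / (1 - p)) := by
  have hlog : Real.log 2 ≠ 0 := (Real.log_pos one_lt_two).ne'
  unfold divBSC Real.logb
  field_simp

/-- From `log t ≤ t - 1` at `t = √b / √a`. Added to its instance for `1 - a`, `1 - b`, it bounds the
divergence below by the squared Hellinger distance. -/
theorem two_mul_sub_sqrt_le_mul_log {a b : ℝ} (ha : 0 < a) (hb : 0 < b) :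
    2 * a - 2 * (√a * √b) ≤ a * Real.log (a / b) := by
  have hsa := Real.sqrt_pos.2 ha
  have hsb := Real.sqrt_pos.2 hb
  have h := Real.log_le_sub_one_of_pos (div_pos hsb hsa)
  rw [Real.log_div hsb.ne' hsa.ne', Real.log_sqrt hb.le, Real.log_sqrt ha.le] at h
  rw [Real.log_div ha.ne' hb.ne']
  have h2 : a * (√b / √a) = √a * √b := by
    field_simp
    rw [Real.sq_sqrt ha.le]
  nlinarith

theorem sq_sub_le_four_mul_sq_sqrt_sub {a b : ℝ} (ha0 : 0 ≤ a) (hb0 : 0 ≤ b) (ha : a ≤ 1)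
    (hb : b ≤ 1) : (a - b) ^ 2 ≤ 4 * (√a - √b) ^ 2 := by
  have e : a - b = (√a - √b) * (√a + √b) := by
    nlinarith [Real.sq_sqrt ha0, Real.sq_sqrt hb0]
  have h1 : √a ≤ 1 := Real.sqrt_le_one.2 ha
  have h2 : √b ≤ 1 := Real.sqrt_le_one.2 hb
  have h3 := Real.sqrt_nonneg a
  have h4 := Real.sqrt_nonneg b
  rw [e, mul_pow]
  have : (√a + √b) ^ 2 ≤ 4 := by nlinarith
  nlinarith [sq_nonneg (√a - √b)]

/-- A weak form of Pinsker's inequality. -/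
theorem sq_sub_le_divBSC {a b : ℝ} (ha0 : 0 < a) (ha1 : a < 1) (hb0 : 0 < b) (hb1 : b < 1) :
    (a - b) ^ 2 / (2 * Real.log 2) ≤ divBSC a b := by
  have hlog : 0 < Real.log 2 := Real.log_pos one_lt_two
  have ha2 : 0 < 1 - a := by linarith
  have hb2 : 0 < 1 - b := by linarith
  rw [div_le_iff₀ (by positivity), ← mul_assoc, mul_right_comm, divBSC_mul_log_two]
  have h1 := two_mul_sub_sqrt_le_mul_log ha0 hb0
  have h2 := two_mul_sub_sqrt_le_mul_log ha2 hb2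
  have h3 := sq_sub_le_four_mul_sq_sqrt_sub ha0.le hb0.le ha1.le hb1.le
  have h4 := sq_sub_le_four_mul_sq_sqrt_sub ha2.le hb2.le (by linarith) (by linarith)
  nlinarith [Real.sq_sqrt ha0.le, Real.sq_sqrt hb0.le, Real.sq_sqrt ha2.le, Real.sq_sqrt hb2.le]

theorem one_div_le_divBSC_div_sq {g η : ℝ} (hg0 : 0 < g) (hη : η ∈ Set.Ioo 0 (1 - g)) :
    1 / (2 * Real.log 2) ≤ divBSC (g + η) g / η ^ 2 := by
  obtain ⟨h0, h1⟩ := hη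
  have := sq_sub_le_divBSC (a := g + η) (b := g) (by linarith) (by linarith) hg0 (by linarith)
  rw [le_div_iff₀ (by positivity)]
  rwa [add_sub_cancel_left, div_eq_inv_mul, ← one_div] at this

/-- Positivity makes the division by `constK g` in `epsBSC` genuine; the weak Pinsker inequality
provides a uniform lower bound. -/
theorem constK_pos {g : ℝ} (hg0 : 0 < g) (hg1 : g < 1) : 0 < constK g := by
  have hlog : 0 < Real.log 2 := Real.log_pos one_lt_two
  refine lt_of_lt_of_le (b := 1 / (2 * Real.log 2)) (by positivity) ?_
  refine le_csInf ((Set.nonempty_Ioo.2 (by linarith)).image _) ?_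
  rintro _ ⟨η, hη, rfl⟩
  exact one_div_le_divBSC_div_sq hg0 hη

theorem constK_mul_sq_le {g η : ℝ} (hg0 : 0 < g) (hη : η ∈ Set.Ioo 0 (1 - g)) :
    constK g * η ^ 2 ≤ divBSC (g + η) g := by
  have h0 : 0 < η := hη.1
  rw [← le_div_iff₀ (by positivity)]
  refine csInf_le ⟨1 / (2 * Real.log 2), ?_⟩ ⟨η, hη, rfl⟩
  rintro _ ⟨η', hη', rfl⟩
  exact one_div_le_divBSC_div_sq hg0 hη'

/-- The number of bit flips of the channel `bsc g` on `n` channel uses rarely exceeds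
`n * g + ε * √n`. -/
theorem bsc_noise_tail {m : ℕ} {g ε x : ℝ} (hg0 : 0 < g) (hg1 : g < 1) (hε : 0 < ε)
    (hx : 0 < x) (hεx : Real.log (2 / x) ≤ constK g * ε ^ 2 * Real.log 2)
    (c : Fin m → Bool) (T : Finset (Fin m)) :
    (Measure.pi fun j => bsc g (c j)).real
      {y | (T.card : ℝ) * g + ε * √T.card < (T.filter fun j => y j ≠ c j).card} ≤ x / 2 := by
  have : ∀ x, IsProbabilityMeasure (bsc g x) := isProbabilityMeasure_bsc hg0.le hg1.le
  have hcard : ∀ y : Fin m → Bool, ((T.filter fun j => y j ≠ c j).card : ℝ) ≤ T.card :=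
    fun y => by exact_mod_cast Finset.card_filter_le _ _
  set n : ℝ := (T.card : ℝ) with hn
  have hempty : n ≤ n * g + ε * √n → (Measure.pi fun j => bsc g (c j)).real
      {y | n * g + ε * √n < (T.filter fun j => y j ≠ c j).card} ≤ x / 2 := by
    intro h
    have : {y : Fin m → Bool | n * g + ε * √n < (T.filter fun j => y j ≠ c j).card} = ∅ := by
      ext y
      simp only [Set.mem_ofPred_eq, Set.mem_empty_iff_false, iff_false, not_lt]
      exact (hcard y).trans h
    rw [this, measureReal_empty]
    positivity
  rcases (Nat.cast_nonneg (α := ℝ) T.card).eq_or_lt with h0 | hpos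
  · exact hempty (by rw [hn, ← h0]; simp)
  rw [← hn] at hpos
  have hs : 0 < √n := Real.sqrt_pos.2 hpos
  have hsq : √n * √n = n := Real.mul_self_sqrt hpos.le
  -- For a large deviation the threshold is at least `n`, and there cannot be more than `n` flips.
  rcases le_or_gt (1 - g) (ε / √n) with hbig | hsmall
  · refine hempty ?_
    rw [le_div_iff₀ hs] at hbig
    nlinarith
  set η := ε / √n with hη
  have hη0 : 0 < η := by positivity
  have hnη : n * η = ε * √n := by
    rw [hη, mul_div_assoc', div_eq_iff hs.ne', mul_assoc, hsq, mul_comm]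
  have hg'1 : g + η < 1 := by linarith
  have h1g : 0 < 1 - g := by linarith
  have h1g' : 0 < 1 - (g + η) := by linarith
  have : ∀ x, IsProbabilityMeasure (bsc (g + η) x) :=
    isProbabilityMeasure_bsc (by linarith) hg'1.le
  have hK := constK_mul_sq_le hg0 ⟨hη0, hsmall⟩
  have hlog : 0 < Real.log 2 := Real.log_pos one_lt_two
  have ha : Real.log (2 / x) ≤ n * (divBSC (g + η) g * Real.log 2) := by
    refine hεx.trans ?_
    have h2 : n * η ^ 2 = ε ^ 2 := by
      rw [sq, ← mul_assoc, hnη, hη]; field_simp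
    calc constK g * ε ^ 2 * Real.log 2 = n * (constK g * η ^ 2 * Real.log 2) := by
          rw [← h2]; ring
      _ ≤ _ := by gcongr
  -- The tilted channel has its mean number of flips at the threshold, so the log-likelihood there
  -- is `n` times `D(g + η ‖ g)` in nats; it increases with further flips.
  have hch := pi_chernoff (μ := fun j => bsc g (c j)) (ν := fun j => bsc (g + η) (c j))
    (r := fun j => llrBSC g (g + η) (c j)) (fun j => measurable_of_finite _)
    (fun j => bsc_eq_withDensity hg0 hg1 (by linarith) hg'1 _) T (Real.log (2 / x))
  rw [Real.exp_neg, Real.exp_log (by positivity), inv_div] at hch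
  refine le_trans (measureReal_mono ?_) hch
  intro y hy
  simp only [Set.mem_ofPred_eq] at hy ⊢
  rw [sum_llrBSC]
  refine ha.trans ?_
  rw [divBSC_mul_log_two]
  have e1 : Real.log (g / (g + η)) = -Real.log ((g + η) / g) := by
    rw [← Real.log_inv, inv_div]
  have e2 : Real.log ((1 - g) / (1 - (g + η))) = -Real.log ((1 - (g + η)) / (1 - g)) := by
    rw [← Real.log_inv, inv_div]
  rw [e1, e2]
  have p1 : 0 ≤ Real.log ((g + η) / g) := Real.log_nonneg (by
    rw [le_div_iff₀ hg0]; linarith)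
  have p2 : Real.log ((1 - (g + η)) / (1 - g)) ≤ 0 := Real.log_nonpos (by positivity) (by
    rw [div_le_one h1g]; linarith)
  have hw : n * (g + η) ≤ ((T.filter fun j => y j ≠ c j).card : ℝ) := by
    rw [mul_add, hnη]; exact hy.le
  have := mul_le_mul_of_nonneg_right hw (sub_nonneg.2 (p2.trans p1))
  rw [← hn]
  linarith

theorem avgErrorProb_bsc_ge {V S M : Type*} {k m ζ : ℕ} (hk : 0 < k) (hm : 0 < m) {p g : ℝ}
    (hp : 0 < p) (hpg : p ≤ g) (hg : g ≤ 1 / 2) (hC : capBSC g < (k : ℝ) / m)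
    (enc : (Fin k → Bool) → Fin m → Bool) (D : Decoder Bool V S M k m ζ) :
    hbInv (deltaBSC ((k : ℝ) / m) g) / 2 * (2 : ℝ) ^ (-(D.maxNbdSize * divBSC g p)) *
      (p * (1 - g) / (g * (1 - p))) ^ (epsBSC ((k : ℝ) / m) g * Real.sqrt D.maxNbdSize) ≤
    avgErrorProb (bsc p) enc D := by
  have hk' : (0 : ℝ) < k := by exact_mod_cast hk
  have hm' : (0 : ℝ) < m := by exact_mod_cast hm
  have hR : (0 : ℝ) < (k : ℝ) / m := by positivity
  have hg0 : 0 < g := hp.trans_le hpg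
  have hg1 : g < 1 := by linarith
  have hp1 : p < 1 := by linarith
  have h1g : 0 < 1 - g := by linarith
  have h1p : 0 < 1 - p := by linarith
  have hlog : 0 < Real.log 2 := Real.log_pos one_lt_two
  have hC0 : 0 ≤ capBSC g := by
    rw [capBSC, hb, sub_nonneg, div_le_one hlog]
    exact Real.binEntropy_le_log_two
  have : ∀ x, IsProbabilityMeasure (bsc g x) := isProbabilityMeasure_bsc hg0.le hg1.le
  have : ∀ x, IsProbabilityMeasure (bsc p x) := isProbabilityMeasure_bsc hp.le hp1.le
  have : ∀ x, IsProbabilityMeasure (bsc (1 / 2) x) :=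
    isProbabilityMeasure_bsc (by norm_num) (by norm_num)
  have hD : ∀ i, Measurable fun y => D.decode y i := fun i => measurable_of_finite _
  have hfano := hbInv_le_avgErrorProb (bsc g) enc D (Q := bsc (1 / 2) true)
    (ℓ := llrBSC g (1 / 2)) hk hm hC0 hC (fun x => measurable_of_finite _)
    (fun x => .of_finite) (fun x => by
      rw [bsc_half_eq true x]
      exact bsc_eq_withDensity hg0 hg1 (by norm_num) (by norm_num) x)
    (by
      simp only [integral_llrBSC_half hg0 hg1, Finset.sum_const, Finset.card_univ,
        Fintype.card_fun, Fintype.card_bool, Fintype.card_fin, nsmul_eq_mul]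
      push_cast
      rw [mul_div_cancel_left₀ _ (by positivity)]) hD
  have hd0 : 0 < deltaBSC ((k : ℝ) / m) g := by
    rw [deltaBSC, sub_pos, div_lt_one hR]; exact hC
  have hd1 : deltaBSC ((k : ℝ) / m) g ≤ 1 := by
    rw [deltaBSC]; linarith [div_nonneg hC0 hR.le]
  rw [← deltaBSC] at hfano
  have hx0 := hbInv_pos hd0 hd1
  have hx1 := (hbInv_mem hd0.le hd1).2
  have hKpos := constK_pos hg0 hg1
  have hεdef : epsBSC ((k : ℝ) / m) g =
    √(1 / constK g * Real.logb 2 (2 / hbInv (deltaBSC ((k : ℝ) / m) g))) := rfl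
  set x := hbInv (deltaBSC ((k : ℝ) / m) g) with hx
  set ε := epsBSC ((k : ℝ) / m) g with hε
  have hlogb : 0 < Real.logb 2 (2 / x) := Real.logb_pos one_lt_two (by
    rw [lt_div_iff₀ hx0]; linarith)
  have hε0 : 0 < ε := by
    rw [hεdef]; positivity
  have hεsq : constK g * ε ^ 2 * Real.log 2 = Real.log (2 / x) := by
    rw [hεdef, Real.sq_sqrt (by positivity), Real.logb]
    field_simp
  set n := D.maxNbdSize with hn
  set ρ := p * (1 - g) / (g * (1 - p)) with hρ
  have hρ0 : 0 < ρ := by positivity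
  have hlogρ : Real.log ρ = Real.log ((1 - g) / (1 - p)) - Real.log (g / p) := by
    rw [← Real.log_div (by positivity) (by positivity), hρ]
    congr 1
    field_simp
  have hρ1 : Real.log ρ ≤ 0 := Real.log_nonpos hρ0.le (by
    rw [hρ, div_le_one (by positivity)]; nlinarith)
  -- `θ` is the log-likelihood ratio at `n * g + ε * √n` flips: the mean contributes the divergence
  -- and each extra flip costs `-log ρ`.
  have main := avgErrorProb_ge_of_test_channel (bsc p) (bsc g) enc D hk hD (r := llrBSC g p)
    (fun x => measurable_of_finite _) (fun x => bsc_eq_withDensity hg0 hg1 hp hp1 x)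
    (θ := n * (divBSC g p * Real.log 2) - ε * √n * Real.log ρ) hfano
    (fun c T hT => by
      refine le_trans (measureReal_mono ?_)
        (bsc_noise_tail hg0 hg1 hε0 hx0 hεsq.ge c T)
      intro y hy
      simp only [Set.mem_ofPred_eq] at hy ⊢
      rw [sum_llrBSC, divBSC_mul_log_two, hT] at hy
      rw [hT]
      by_contra! hle
      have := mul_le_mul_of_nonneg_right hle (neg_nonneg.2 hρ1)
      rw [hlogρ] at this hy
      linarith)
  refine le_trans (le_of_eq ?_) main
  rw [Real.rpow_def_of_pos two_pos, Real.rpow_def_of_pos hρ0, mul_assoc, ← Real.exp_add, mul_comm]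
  congr 2
  ring

/-! ### The additive white Gaussian noise channel -/

/-- The log-likelihood ratio of the Gaussian distributions with means `x`, `a` and variances `v`,
`v'`. -/
def llrGaussian (x : ℝ) (v : ℝ≥0) (a : ℝ) (v' : ℝ≥0) (y : ℝ) : ℝ :=
  1 / 2 * Real.log (v' / v) - (y - x) ^ 2 / (2 * v) + (y - a) ^ 2 / (2 * v')

theorem measurable_llrGaussian (x : ℝ) (v : ℝ≥0) (a : ℝ) (v' : ℝ≥0) :
    Measurable (llrGaussian x v a v') := by
  unfold llrGaussian
  fun_prop

theorem gaussianPDFReal_mul_exp_llr (x a : ℝ) {v v' : ℝ≥0} (hv : 0 < v) (hv' : 0 < v') (y : ℝ) :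
    gaussianPDFReal x v y * Real.exp (-llrGaussian x v a v' y) = gaussianPDFReal a v' y := by
  have hv : (0 : ℝ) < v := hv
  have hv' : (0 : ℝ) < v' := hv'
  have e : ∀ w : ℝ, 0 < w → (√(2 * Real.pi * w))⁻¹ =
      Real.exp (-(1 / 2 * (Real.log (2 * Real.pi) + Real.log w))) := by
    intro w hw
    rw [Real.exp_neg, ← Real.log_mul (by positivity) hw.ne', mul_comm (1 / 2 : ℝ),
      ← Real.rpow_def_of_pos (by positivity), Real.sqrt_eq_rpow]
  rw [gaussianPDFReal, gaussianPDFReal, e v hv, e v' hv', ← Real.exp_add, ← Real.exp_add,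
    ← Real.exp_add, llrGaussian, Real.log_div hv'.ne' hv.ne']
  congr 1
  ring

theorem gaussianReal_eq_withDensity (x a : ℝ) {v v' : ℝ≥0} (hv : 0 < v) (hv' : 0 < v') :
    gaussianReal a v' = (gaussianReal x v).withDensity
      fun y => ENNReal.ofReal (Real.exp (-llrGaussian x v a v' y)) := by
  have hm : Measurable fun y => ENNReal.ofReal (Real.exp (-llrGaussian x v a v' y)) :=
    (Real.measurable_exp.comp (measurable_llrGaussian x v a v').neg).ennreal_ofReal
  rw [gaussianReal_of_var_ne_zero _ hv.ne', gaussianReal_of_var_ne_zero _ hv'.ne',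
    ← withDensity_mul _ (measurable_gaussianPDF x v) hm]
  congr 1
  ext1 y
  rw [Pi.mul_apply, gaussianPDF, gaussianPDF,
    ← ENNReal.ofReal_mul (gaussianPDFReal_nonneg _ _ _), gaussianPDFReal_mul_exp_llr x a hv hv']

theorem integrable_sub_sq_gaussianReal (x a : ℝ) (v : ℝ≥0) :
    Integrable (fun y => (y - a) ^ 2) (gaussianReal x v) :=
  ((memLp_id_gaussianReal 2).sub (memLp_const a)).integrable_sq

theorem integral_sub_sq_gaussianReal (x : ℝ) (v : ℝ≥0) :
    ∫ y, (y - x) ^ 2 ∂gaussianReal x v = v := by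
  have h := variance_fun_id_gaussianReal (μ := x) (v := v)
  rwa [variance_eq_integral (by fun_prop), integral_id_gaussianReal] at h

theorem integral_sq_gaussianReal (x : ℝ) (v : ℝ≥0) :
    ∫ y, y ^ 2 ∂gaussianReal x v = v + x ^ 2 := by
  have h := variance_id_gaussianReal (μ := x) (v := v)
  rw [variance_eq_sub (memLp_id_gaussianReal 2)] at h
  simp only [Pi.pow_apply, id_eq, integral_id_gaussianReal] at h
  linarith

theorem integrable_llrGaussian (x : ℝ) (v : ℝ≥0) (a : ℝ) (v' : ℝ≥0) :
    Integrable (llrGaussian x v a v') (gaussianReal x v) :=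
  ((integrable_const _).sub ((integrable_sub_sq_gaussianReal x x v).div_const _)).add
    ((integrable_sub_sq_gaussianReal x a v).div_const _)

/-- The cost is affine in `x ^ 2`, so an average power constraint on the codebook is enough. -/
theorem integral_llrGaussian_zero (x : ℝ) {v : ℝ≥0} (hv : 0 < v) (v' : ℝ≥0) :
    ∫ y, llrGaussian x v 0 v' y ∂gaussianReal x v =
      1 / 2 * Real.log (v' / v) - 1 / 2 + (v + x ^ 2) / (2 * v') := by
  have hv : (0 : ℝ) < v := hv
  have h1 : Integrable (fun y => (y - x) ^ 2 / (2 * (v : ℝ))) (gaussianReal x v) :=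
    (integrable_sub_sq_gaussianReal x x v).div_const _
  have h2 : Integrable (fun y => (y - 0) ^ 2 / (2 * (v' : ℝ))) (gaussianReal x v) :=
    (integrable_sub_sq_gaussianReal x 0 v).div_const _
  have h3 : Integrable (fun y => 1 / 2 * Real.log (v' / v) - (y - x) ^ 2 / (2 * (v : ℝ)))
      (gaussianReal x v) := (integrable_const _).sub h1
  unfold llrGaussian
  rw [integral_add h3 h2, integral_sub (integrable_const _) h1, integral_div, integral_div,
    integral_sub_sq_gaussianReal]
  simp only [sub_zero, integral_sq_gaussianReal, integral_const, probReal_univ, one_smul]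
  congr 2
  field_simp

theorem sum_llrGaussian_self {m : ℕ} {v v' : ℝ≥0} (c y : Fin m → ℝ) (T : Finset (Fin m)) :
    ∑ j ∈ T, llrGaussian (c j) v (c j) v' (y j) =
      T.card * (1 / 2 * Real.log (v' / v)) +
        (∑ j ∈ T, (y j - c j) ^ 2) * (1 / (2 * v') - 1 / (2 * v)) := by
  unfold llrGaussian
  rw [Finset.sum_mul, ← nsmul_eq_mul, ← Finset.sum_const, ← Finset.sum_add_distrib]
  exact Finset.sum_congr rfl fun j _ => by ring

/-- A tail bound for the chi-squared distribution with `n` degrees of freedom. -/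
theorem gaussian_noise_tail {m : ℕ} {v : ℝ≥0} (hv : 0 < v) {t : ℝ} (c : Fin m → ℝ)
    (T : Finset (Fin m)) :
    (Measure.pi fun j => gaussianReal (c j) v).real
      {y | v * (T.card + √T.card * (3 + 4 * t)) < ∑ j ∈ T, (y j - c j) ^ 2} ≤ Real.exp (-t) := by
  have hvr : (0 : ℝ) < v := hv
  rcases Nat.eq_zero_or_pos T.card with h0 | hpos
  · rw [Finset.card_eq_zero] at h0
    subst h0
    simp [(Real.exp_pos _).le]
  have hn1 : (1 : ℝ) ≤ T.card := by exact_mod_cast hpos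
  set n : ℝ := (T.card : ℝ) with hn
  have hs1 : 1 ≤ √n := Real.one_le_sqrt.2 hn1
  have hsq : √n * √n = n := Real.mul_self_sqrt (by linarith)
  -- With `u * √n = 1 / 2` the second-order loss `n * u ^ 2` is `1 / 4`, while the excess `√n * (3 +
  -- 4 * t)` contributes `3 / 4 + t`.
  set u : ℝ := 1 / (2 * √n) with hu
  have hu0 : 0 < u := by positivity
  have hu1 : u ≤ 1 / 2 := by
    rw [hu, div_le_div_iff₀ (by positivity) two_pos]; linarith
  have hus : u * √n = 1 / 2 := by rw [hu]; field_simp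
  have h1u : 0 < 1 - u := by linarith
  -- Variance inflation is exponential tilting of the noise energy: the likelihood ratio depends on
  -- `y` only through that energy.
  let v' : ℝ≥0 := ⟨v / (1 - u), by positivity⟩
  have hv'r : (v' : ℝ) = v / (1 - u) := rfl
  have hv' : 0 < v' := by
    rw [← NNReal.coe_pos, hv'r]; positivity
  have hch := pi_chernoff (μ := fun j => gaussianReal (c j) v)
    (ν := fun j => gaussianReal (c j) v') (r := fun j => llrGaussian (c j) v (c j) v')
    (fun j => measurable_llrGaussian _ _ _ _)
    (fun j => gaussianReal_eq_withDensity _ _ hv hv') T t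
  refine le_trans (measureReal_mono ?_) hch
  intro y hy
  simp only [Set.mem_ofPred_eq] at hy ⊢
  rw [sum_llrGaussian_self, ← hn, hv'r]
  have e1 : Real.log (v / (1 - u) / v) = -Real.log (1 - u) := by
    rw [← Real.log_inv]; congr 1; field_simp
  have e2 : 1 / (2 * ((v : ℝ) / (1 - u))) - 1 / (2 * v) = -(u / (2 * v)) := by
    field_simp; ring
  rw [e1, e2]
  have hlog : -u - 2 * u ^ 2 ≤ Real.log (1 - u) := by
    refine le_trans ?_ (Real.one_sub_inv_le_log_of_pos h1u)
    have : (1 - u)⁻¹ ≤ 1 + u + 2 * u ^ 2 := by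
      rw [inv_le_iff_one_le_mul₀ h1u]; nlinarith [sq_nonneg u]
    linarith
  have h1 : n * (-u - 2 * u ^ 2) ≤ n * Real.log (1 - u) :=
    mul_le_mul_of_nonneg_left hlog (by linarith)
  have h2 : u / (2 * v) * (v * (n + √n * (3 + 4 * t))) ≤
      u / (2 * v) * ∑ j ∈ T, (y j - c j) ^ 2 :=
    mul_le_mul_of_nonneg_left hy.le (by positivity)
  have e3 : u / (2 * v) * (v * (n + √n * (3 + 4 * t))) = n * u / 2 + (u * √n) * (3 + 4 * t) / 2 := by
    field_simp
  have e4 : n * u ^ 2 = (u * √n) * (u * √n) := by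
    rw [mul_mul_mul_comm, hsq]; ring
  rw [e3, hus] at h2
  rw [hus] at e4
  nlinarith

theorem avgErrorProb_awgn_ge {V S M : Type*} {k m ζ : ℕ} (hk : 0 < k) (hm : 0 < m) {PR : ℝ}
    (hPR : 0 ≤ PR) {v₀ v : ℝ≥0} (hv₀ : 0 < v₀) (hv : v₀ ≤ v)
    (hC : capAWGN PR v < (k : ℝ) / m)
    (enc : (Fin k → Bool) → Fin m → ℝ) (D : Decoder ℝ V S M k m ζ)
    (hpow : (∑ b, ∑ j, enc b j ^ 2) / (2 ^ k * m) ≤ PR)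
    (hD : ∀ i, Measurable fun y => D.decode y i) :
    hbInv (deltaAWGN ((k : ℝ) / m) PR v) / 2 *
      Real.exp (-(D.maxNbdSize * divAWGN v v₀) - Real.sqrt D.maxNbdSize *
        (3 / 2 + 2 * Real.log (2 / hbInv (deltaAWGN ((k : ℝ) / m) PR v))) * (v / v₀ - 1)) ≤
    avgErrorProb (awgn v₀) enc D := by
  have hk' : (0 : ℝ) < k := by exact_mod_cast hk
  have hm' : (0 : ℝ) < m := by exact_mod_cast hm
  have hR : (0 : ℝ) < (k : ℝ) / m := by positivity
  have hv0 : 0 < v := hv₀.trans_le hv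
  have hv₀r : (0 : ℝ) < v₀ := hv₀
  have hvr : (0 : ℝ) < v := hv0
  have hvle : (v₀ : ℝ) ≤ v := hv
  have hC0 : 0 ≤ capAWGN PR v := by
    unfold capAWGN
    have := Real.logb_nonneg one_lt_two
      (show (1 : ℝ) ≤ 1 + PR / v by linarith [div_nonneg hPR hvr.le])
    linarith
  have : ∀ x, IsProbabilityMeasure (awgn v x) := fun x =>
    inferInstanceAs (IsProbabilityMeasure (gaussianReal x v))
  have : ∀ x, IsProbabilityMeasure (awgn v₀ x) := fun x =>
    inferInstanceAs (IsProbabilityMeasure (gaussianReal x v₀))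
  -- The variance of the capacity-achieving output; at average power `PR` the two non-logarithmic
  -- terms of the cost cancel and leave the capacity.
  let s : ℝ≥0 := ⟨PR + v, by positivity⟩
  have hsr : (s : ℝ) = PR + v := rfl
  have hsr0 : (0 : ℝ) < s := by rw [hsr]; positivity
  have hlog2 : Real.log 2 ≠ 0 := (Real.log_pos one_lt_two).ne'
  have hcap : capAWGN PR v * Real.log 2 = 1 / 2 * Real.log (s / v) := by
    rw [capAWGN, Real.logb, hsr, add_div, div_self hvr.ne', add_comm]
    field_simp
  have hfano := hbInv_le_avgErrorProb (awgn v) enc D (Q := gaussianReal 0 s)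
    (ℓ := fun x => llrGaussian x v 0 s) hk hm hC0 hC (fun x => measurable_llrGaussian _ _ _ _)
    (fun x => integrable_llrGaussian _ _ _ _)
    (fun x => gaussianReal_eq_withDensity x 0 hv0 hsr0) (by
      rw [div_le_iff₀ (by positivity)] at hpow ⊢
      simp only [awgn, integral_llrGaussian_zero _ hv0]
      have e : ∀ b j, 1 / 2 * Real.log (s / v) - 1 / 2 + (v + enc b j ^ 2) / (2 * s) =
          (1 / 2 * Real.log (s / v) - 1 / 2 + v / (2 * s)) + enc b j ^ 2 * (1 / (2 * s)) :=
        fun b j => by ring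
      simp only [e, Finset.sum_add_distrib, ← Finset.sum_mul, Finset.sum_const, Finset.card_univ,
        Fintype.card_fun, Fintype.card_bool, Fintype.card_fin, nsmul_eq_mul]
      push_cast
      have h1 := mul_le_mul_of_nonneg_right hpow (show (0 : ℝ) ≤ 1 / (2 * s) by positivity)
      have h2 : (PR + v) / (2 * s) = 1 / 2 := by
        rw [← hsr]; field_simp
      have h3 : PR * (2 ^ k * m) * (1 / (2 * s)) = 2 ^ k * m * (1 / 2 - v / (2 * s)) := by
        rw [← h2]; ring
      rw [hcap]
      rw [h3] at h1
      nlinarith) hD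
  have hd0 : 0 < deltaAWGN ((k : ℝ) / m) PR v := by
    rw [deltaAWGN, sub_pos, div_lt_one hR]; exact hC
  have hd1 : deltaAWGN ((k : ℝ) / m) PR v ≤ 1 := by
    rw [deltaAWGN]; linarith [div_nonneg hC0 hR.le]
  rw [← deltaAWGN] at hfano
  have hx0 := hbInv_pos hd0 hd1
  set x := hbInv (deltaAWGN ((k : ℝ) / m) PR v) with hx
  set n := D.maxNbdSize with hn
  set t := Real.log (2 / x) with ht
  have hexp : Real.exp (-t) = x / 2 := by
    rw [ht, ← Real.log_inv, Real.exp_log (by positivity), inv_div]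
  -- `θ` is the log-likelihood ratio at noise energy `v * (n + √n * (3 + 4 * t))`; `t = log (2 / x)`
  -- makes the tail exactly `x / 2`.
  have main := avgErrorProb_ge_of_test_channel (awgn v₀) (awgn v) enc D hk hD
    (r := fun x => llrGaussian x v x v₀) (fun x => measurable_llrGaussian _ _ _ _)
    (fun x => gaussianReal_eq_withDensity x x hv0 hv₀)
    (θ := n * divAWGN v v₀ + √n * (3 / 2 + 2 * t) * (v / v₀ - 1)) hfano
    (fun c T hT => by
      rw [← hexp]
      refine le_trans (measureReal_mono ?_) (gaussian_noise_tail hv0 c T)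
      intro y hy
      simp only [Set.mem_ofPred_eq] at hy ⊢
      rw [sum_llrGaussian_self, hT] at hy
      rw [hT]
      by_contra! hle
      have hd : (0 : ℝ) ≤ 1 / (2 * v₀) - 1 / (2 * v) :=
        sub_nonneg.2 (one_div_le_one_div_of_le (by positivity) (by linarith))
      have h1 := mul_le_mul_of_nonneg_right hle hd
      have e1 : Real.log (v₀ / v) = -Real.log (v / v₀) := by
        rw [← Real.log_inv, inv_div]
      have e2 : v * (n + √n * (3 + 4 * t)) * (1 / (2 * (v₀ : ℝ)) - 1 / (2 * v)) =
          (n + √n * (3 + 4 * t)) * (1 / 2 * (v / v₀ - 1)) := by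
        field_simp
      rw [e2] at h1
      rw [e1, divAWGN] at hy
      linarith)
  refine le_trans (le_of_eq ?_) main
  rw [mul_comm]
  congr 2
  ring

end VLSIDecoding

end

theorem mainTheorem1 {Y V S M : Type*} [Fintype V] (k m ζ : ℕ) (hk : 0 < k) (hm : 0 < m)
    (ξT ξD PR Enode Rdec : ℝ) (hξT : 0 < ξT) (hξD : 0 < ξD) (hPR : 0 ≤ PR)
    (hEnode : 0 < Enode) (hRdec : 0 < Rdec) (Rch : ℝ) (hRch : Rch = (k : ℝ) / m) :
    -- iterations and total power in terms of the maximum neighbourhood size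
    (∀ (D : VLSIDecoding.Decoder Y V S M k m ζ) (n l : ℕ), n = D.maxNbdSize → l = D.iterations →
      Enode * m * l ≤ D.decodingEnergy Enode ∧
      (2 < ζ →
        (n : ℝ) ≤ ζ * ((((ζ : ℝ) - 1) ^ l - 1) / ((ζ : ℝ) - 2)) + 1 ∧
        Real.log (((ζ : ℝ) - 2) / ζ * n + 2 / ζ) / Real.log ((ζ : ℝ) - 1) ≤ l ∧
        VLSIDecoding.totalPowerBound ξT ξD PR Enode Rdec Rch ζ n ≤
          D.totalPower ξT ξD PR Enode Rdec) ∧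
      (ζ = 2 → n ≤ 2 * l + 1 ∧ ((n : ℝ) - 1) / 2 ≤ l)) ∧
    -- binary symmetric channel
    (∀ (p : ℝ), 0 < p → p < 1 / 2 →
      ∀ (enc : (Fin k → Bool) → Fin m → Bool) (D : VLSIDecoding.Decoder Bool V S M k m ζ),
      VLSIDecoding.spherePackingBSC p Rch D.maxNbdSize ≤
        (VLSIDecoding.avgErrorProb (VLSIDecoding.bsc p) enc D : EReal) ∧
      ∀ (Pe : ℝ), VLSIDecoding.avgErrorProb (VLSIDecoding.bsc p) enc D ≤ Pe →
        VLSIDecoding.requiredNbd (VLSIDecoding.spherePackingBSC p Rch) Pe ≤ D.maxNbdSize ∧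
        (2 < ζ →
          VLSIDecoding.totalPowerBound ξT ξD PR Enode Rdec Rch ζ
              (VLSIDecoding.requiredNbd (VLSIDecoding.spherePackingBSC p Rch) Pe) ≤
            D.totalPower ξT ξD PR Enode Rdec)) ∧
    -- AWGN channel with average received power at most `PR`
    (∀ (v₀ : ℝ≥0), 0 < v₀ →
      ∀ (enc : (Fin k → Bool) → Fin m → ℝ) (D : VLSIDecoding.Decoder ℝ V S M k m ζ),
      (∑ b, ∑ j, enc b j ^ 2) / (2 ^ k * m) ≤ PR →
      (∀ i, Measurable fun y => D.decode y i) →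
      VLSIDecoding.spherePackingAWGN v₀ PR Rch D.maxNbdSize ≤
        (VLSIDecoding.avgErrorProb (VLSIDecoding.awgn v₀) enc D : EReal) ∧
      ∀ (Pe : ℝ), VLSIDecoding.avgErrorProb (VLSIDecoding.awgn v₀) enc D ≤ Pe →
        VLSIDecoding.requiredNbd (VLSIDecoding.spherePackingAWGN v₀ PR Rch) Pe ≤ D.maxNbdSize ∧
        (2 < ζ →
          VLSIDecoding.totalPowerBound ξT ξD PR Enode Rdec Rch ζ
              (VLSIDecoding.requiredNbd (VLSIDecoding.spherePackingAWGN v₀ PR Rch) Pe) ≤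
            D.totalPower ξT ξD PR Enode Rdec)) := by
  subst hRch
  refine ⟨?_, ?_, ?_⟩
  · rintro D n l rfl rfl
    refine ⟨D.le_decodingEnergy hEnode.le, fun hζ => ⟨D.maxNbdSize_le hζ, D.log_le_iterations hζ,
      D.totalPowerBound_le hξD hEnode hRdec hk hm hζ⟩, fun hζ => ?_⟩
    have h := D.maxNbdSize_le_of_two hζ
    refine ⟨h, ?_⟩
    have h' : (D.maxNbdSize : ℝ) ≤ 2 * D.iterations + 1 := by exact_mod_cast h
    linarith
  · intro p hp0 _ enc D
    have hB : VLSIDecoding.spherePackingBSC p ((k : ℝ) / m) D.maxNbdSize ≤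
        (VLSIDecoding.avgErrorProb (VLSIDecoding.bsc p) enc D : EReal) :=
      -- In `EReal` a supremum over no admissible test channel is `⊥`, so that case is vacuous.
      iSup₂_le fun g hg => EReal.coe_le_coe_iff.2
        (VLSIDecoding.avgErrorProb_bsc_ge hk hm hp0 hg.1 hg.2.1 hg.2.2 enc D)
    exact ⟨hB, fun Pe hPe =>
      VLSIDecoding.power_of_spherePacking hk hm hξD hEnode hRdec D hB hPe⟩
  · intro v₀ hv₀ enc D hpow hD
    have hB : VLSIDecoding.spherePackingAWGN v₀ PR ((k : ℝ) / m) D.maxNbdSize ≤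
        (VLSIDecoding.avgErrorProb (VLSIDecoding.awgn v₀) enc D : EReal) := by
      refine iSup₂_le fun v hv => EReal.coe_le_coe_iff.2 ?_
      lift v to ℝ≥0 using v₀.2.trans hv.1
      exact VLSIDecoding.avgErrorProb_awgn_ge hk hm hPR hv₀ hv.1 hv.2 enc D hpow hD
    exact ⟨hB, fun Pe hPe =>
      VLSIDecoding.power_of_spherePacking hk hm hξD hEnode hRdec D hB hPe⟩
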